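/- For a finite bipartite graph $G=(U,V,E)$ let $C^*(G)$ be the universal unital C*-algebra generated by projections $(p_x)_{x\in U\cup V}$ subject to the relations $\sum_{u\in U}p_u=1=\sum_{v\in V}p_v$ and $p_up_v=0$ whenever $u\in U$, $v\in V$ and $\{u,v\}\notin E$. For an integer $n\ge 1$ the hypercube $Q_n=(U_n,V_n,E_n)$ is the bipartite graph whose vertices are the binary sequences $x=(x_0,\dots,x_{n-1})\in\{0,1\}^n$; $U_n$ consists of those with an even number of ones, $V_n$ of those with an odd number of ones, and $i\in U_n$, $j\in V_n$ are adjacent if and only if $j$ arises from $i$ by flipping the $k$-th digit for some $0\le k<n$ (an edge in direction $k$). Let $\Delta_{n-1}=\{\mathbf t=(t_0,\dots,t_{n-1})\in\mathbb R^n : t_k\ge 0,\ \sum_k t_k=1\}$. For $\mathbf t\in\Delta_{n-1}$ let $Q_n(\mathbf t)$ be the subgraph of $Q_n$, with the same vertices, obtained by removing all edges in those directions $k$ with $t_k=0$. A complex matrix $A=(A_{i_1i_2})_{i_1,i_2\in U_n}\in M_{U_n}$ is in $\mathbf t$-block diagonal form if $A_{i_1i_2}=0$ whenever $i_1,i_2$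 lie in distinct connected components of $Q_n(\mathbf t)$. **Theorem.** For every $n\ge 1$ one has $|U_n|=2^{n-1}$ (so that $M_{U_n}\cong M_{2^{n-1}}$), and $C^*(Q_n)$ is isomorphic, as a $*$-algebra (equivalently, as a C*-algebra), to the algebra $$\{f\in C(\Delta_{n-1},M_{U_n}) : f(\mathbf t)\text{ is in }\mathbf t\text{-block diagonal form for all }\mathbf t\in\Delta_{n-1}\}$$ with pointwise operations. For $n=2$ this is Pedersen's description of the universal unital C*-algebra $C^*(p,q)$ generated by two projections: $C^*(p,q)\cong C^*(Q_2)$, and $C^*(p,q)\cong\{f\in C([0,1],M_2) : f(0)\text{ and }f(1)\text{ are diagonal}\}$. -/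

import Mathlib

/-!
## Universal C*-algebras generated by projections subject to polynomial relations
-/

/-- The free unital complex `*`-algebra on self-adjoint generators indexed by `X`: noncommutative
polynomials, with the involution that conjugates coefficients and reverses words. -/
def StarPoly (X : Type*) : Type _ := FreeAlgebra ℂ X

namespace StarPoly

variable {X : Type*}

noncomputable instance : Ring (StarPoly X) := inferInstanceAs (Ring (FreeAlgebra ℂ X))

noncomputable instance : Algebra ℂ (StarPoly X) := inferInstanceAs (Algebra ℂ (FreeAlgebra ℂ X))

/-- The generator with index `x`. -/
def gen (x : X) : StarPoly X := FreeAlgebra.ι ℂ x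

/-- Evaluation of a noncommutative polynomial at a family of elements of a unital algebra. -/
noncomputable def eval {A : Type*} [Ring A] [Algebra ℂ A] (f : X → A) : StarPoly X →ₐ[ℂ] A :=
  FreeAlgebra.lift ℂ f

@[simp] theorem eval_gen {A : Type*} [Ring A] [Algebra ℂ A] (f : X → A) (x : X) :
    eval f (gen x) = f x :=
  FreeAlgebra.lift_ι_apply f x

/-- Induction principle: the polynomials are generated by scalars and generators. -/
theorem induction_on {P : StarPoly X → Prop} (a : StarPoly X)
    (hs : ∀ c : ℂ, P (algebraMap ℂ _ c)) (hg : ∀ x, P (gen x))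
    (ha : ∀ a b, P a → P b → P (a + b)) (hm : ∀ a b, P a → P b → P (a * b)) : P a :=
  FreeAlgebra.induction (R := ℂ) (X := X) (motive := P) hs hg
    (fun a b => hm a b) (fun a b => ha a b) a

/-- The opposite algebra, with complex scalars acting through their conjugates. -/
@[reducible] noncomputable def conjOpAlgebra : Algebra ℂ (StarPoly X)ᵐᵒᵖ :=
  RingHom.toAlgebra' ((algebraMap ℂ (StarPoly X)ᵐᵒᵖ).comp (starRingEnd ℂ))
    (fun c a => Algebra.commutes (starRingEnd ℂ c) a)

/-- The conjugate-linear map that reverses words and fixes the generators, as a ring homomorphism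
into the opposite ring. -/
noncomputable def starHom : StarPoly X →+* (StarPoly X)ᵐᵒᵖ :=
  letI := conjOpAlgebra (X := X)
  (eval fun x => MulOpposite.op (gen x)).toRingHom

theorem starHom_gen (x : X) : starHom (gen x) = MulOpposite.op (gen x) :=
  letI := conjOpAlgebra (X := X)
  eval_gen (fun x => MulOpposite.op (gen x)) x

theorem starHom_algebraMap (c : ℂ) :
    starHom (algebraMap ℂ (StarPoly X) c) = algebraMap ℂ _ (starRingEnd ℂ c) :=
  @AlgHom.commutes ℂ (StarPoly X) (StarPoly X)ᵐᵒᵖ _ _ _ _ conjOpAlgebra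
    (@eval X _ _ conjOpAlgebra fun x : X => MulOpposite.op (gen x)) c

/-- The involution: conjugate the coefficients, reverse the words, fix the generators. -/
noncomputable instance : StarRing (StarPoly X) where
  star a := (starHom a).unop
  star_involutive a := by
    change (starHom (starHom a).unop).unop = a
    induction a using StarPoly.induction_on with
    | hs c => simp [starHom_algebraMap]
    | hg x => simp [starHom_gen]
    | ha a b iha ihb => simp [iha, ihb]
    | hm a b iha ihb => simp [iha, ihb]
  star_mul a b := by
    change (starHom (a * b)).unop = _
    simp
  star_add a b := by
    change (starHom (a + b)).unop = _
    simp

@[simp] theorem star_gen (x : X) : star (gen x) = gen x := by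
  change (starHom (gen x)).unop = _
  simp [starHom_gen]

@[simp] theorem star_algebraMap' (c : ℂ) :
    star (algebraMap ℂ (StarPoly X) c) = algebraMap ℂ _ (starRingEnd ℂ c) := by
  change (starHom _).unop = _
  simp [starHom_algebraMap]

noncomputable instance : StarModule ℂ (StarPoly X) where
  star_smul c a := by
    rw [Algebra.smul_def, star_mul, star_algebraMap', Algebra.smul_def, Algebra.commutes]
    rfl

theorem eval_star {A : Type*} [Ring A] [StarRing A] [Algebra ℂ A] [StarModule ℂ A] (f : X → A)
    (hf : ∀ x, IsSelfAdjoint (f x)) (a : StarPoly X) : eval f (star a) = star (eval f a) := by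
  induction a using StarPoly.induction_on with
  | hs c => simpa using algebraMap_star_comm c
  | hg x => simp [(hf x).star_eq]
  | ha a b iha ihb => simp [iha, ihb]
  | hm a b iha ihb => simp [iha, ihb]

/-- A C*-seminorm on the noncommutative polynomials for which the generators are projections and
the relations `r = 0` hold for `r ∈ R`. -/
structure CStarSeminorm (R : Set (StarPoly X)) extends Seminorm ℂ (StarPoly X) where
  mul_le' : ∀ a b, toFun (a * b) ≤ toFun a * toFun b
  star_mul_self' : ∀ a, toFun (star a * a) = toFun a ^ 2
  proj' : ∀ x, toFun (gen x * gen x - gen x) = 0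
  rel' : ∀ r ∈ R, toFun r = 0

namespace CStarSeminorm

variable {R : Set (StarPoly X)}

theorem star_eq (q : CStarSeminorm R) (a : StarPoly X) :
    q.toSeminorm (star a) = q.toSeminorm a := by
  have key : ∀ b, q.toSeminorm b ≤ q.toSeminorm (star b) := by
    intro b
    have h1 : q.toSeminorm (star b * b) = q.toSeminorm b ^ 2 := q.star_mul_self' b
    have h2 : q.toSeminorm (star b * b) ≤ q.toSeminorm (star b) * q.toSeminorm b := q.mul_le' _ _
    have h3 := apply_nonneg q.toSeminorm b
    have h4 := apply_nonneg q.toSeminorm (star b)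
    by_contra! h
    nlinarith
  refine le_antisymm ?_ (key a)
  simpa using key (star a)

theorem le_one_of_sq {s : ℝ} (h : s = s ^ 2) : s ≤ 1 := by nlinarith [sq_nonneg (s - 1)]

theorem one_le (q : CStarSeminorm R) : q.toSeminorm 1 ≤ 1 := by
  have h : q.toSeminorm (star 1 * 1) = q.toSeminorm 1 ^ 2 := q.star_mul_self' 1
  rw [star_one, mul_one] at h
  exact le_one_of_sq h

theorem gen_le (q : CStarSeminorm R) (x : X) : q.toSeminorm (gen x) ≤ 1 := by
  have h : q.toSeminorm (star (gen x) * gen x) = q.toSeminorm (gen x) ^ 2 := q.star_mul_self' _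
  have h0 : q.toSeminorm (gen x * gen x - gen x) = 0 := q.proj' x
  have h1 : q.toSeminorm (gen x * gen x) ≤ q.toSeminorm (gen x * gen x - gen x) +
      q.toSeminorm (gen x) := by
    simpa using map_add_le_add q.toSeminorm (gen x * gen x - gen x) (gen x)
  rw [star_gen] at h
  have h3 := apply_nonneg q.toSeminorm (gen x)
  by_contra! h4
  nlinarith

theorem bddAbove (R : Set (StarPoly X)) (a : StarPoly X) :
    BddAbove (Set.range fun q : CStarSeminorm R => q.toSeminorm a) := by
  suffices ∃ C : ℝ, ∀ q : CStarSeminorm R, q.toSeminorm a ≤ C by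
    obtain ⟨C, hC⟩ := this
    exact ⟨C, by rintro _ ⟨q, rfl⟩; exact hC q⟩
  induction a using StarPoly.induction_on with
  | hs c =>
    refine ⟨‖c‖, fun q => ?_⟩
    rw [Algebra.algebraMap_eq_smul_one, map_smul_eq_mul]
    exact mul_le_of_le_one_right (norm_nonneg c) q.one_le
  | hg x => exact ⟨1, fun q => q.gen_le x⟩
  | ha a b iha ihb =>
    obtain ⟨C, hC⟩ := iha
    obtain ⟨D, hD⟩ := ihb
    exact ⟨C + D, fun q => (map_add_le_add _ _ _).trans (add_le_add (hC q) (hD q))⟩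
  | hm a b iha ihb =>
    obtain ⟨C, hC⟩ := iha
    obtain ⟨D, hD⟩ := ihb
    exact ⟨C * D, fun q => (q.mul_le' a b).trans (mul_le_mul (hC q) (hD q)
      (apply_nonneg q.toSeminorm b) ((apply_nonneg q.toSeminorm a).trans (hC q)))⟩

/-- The zero seminorm. -/
noncomputable def zero (R : Set (StarPoly X)) : CStarSeminorm R where
  toSeminorm := 0
  mul_le' _ _ := (mul_zero (0 : ℝ)).ge
  star_mul_self' _ := (zero_pow two_ne_zero).symm
  proj' _ := rfl
  rel' _ _ := rfl

instance : Nonempty (CStarSeminorm R) := ⟨zero R⟩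

/-- The seminorm on polynomials that is induced by a family of projections satisfying the
relations in a C*-algebra. -/
noncomputable def ofFamily {B : Type*} [CStarAlgebra B] (f : X → B) (hf : ∀ x, IsStarProjection (f x))
    (hR : ∀ r ∈ R, eval f r = 0) : CStarSeminorm R where
  toFun a := ‖eval f a‖
  map_zero' := by simp
  add_le' a b := by simpa using norm_add_le (eval f a) (eval f b)
  neg' a := by simp
  smul' c a := by simp [norm_smul]
  mul_le' a b := by simpa using norm_mul_le (eval f a) (eval f b)
  star_mul_self' a := by
    rw [map_mul, eval_star f (fun x => (hf x).isSelfAdjoint), CStarRing.norm_star_mul_self, sq]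
  proj' x := by simp [(hf x).isIdempotentElem.eq]
  rel' r hr := by simp [hR r hr]

end CStarSeminorm

end StarPoly

/-- The noncommutative polynomials, equipped with the largest C*-seminorm for which the generators
are projections and the relations in `R` hold. -/
def PreUniversalCStar {X : Type*} (_R : Set (StarPoly X)) : Type _ := StarPoly X

namespace PreUniversalCStar

open StarPoly

variable {X : Type*} (R : Set (StarPoly X))

noncomputable instance : Ring (PreUniversalCStar R) := inferInstanceAs (Ring (StarPoly X))
noncomputable instance : Algebra ℂ (PreUniversalCStar R) :=
  inferInstanceAs (Algebra ℂ (StarPoly X))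
noncomputable instance : StarRing (PreUniversalCStar R) := inferInstanceAs (StarRing (StarPoly X))
noncomputable instance : StarModule ℂ (PreUniversalCStar R) :=
  inferInstanceAs (StarModule ℂ (StarPoly X))

/-- The universal seminorm: the supremum of all C*-seminorms compatible with the relations. -/
noncomputable instance : Norm (PreUniversalCStar R) where
  norm a := ⨆ q : CStarSeminorm R, q.toSeminorm a

variable {R}

theorem norm_def (a : PreUniversalCStar R) :
    ‖a‖ = ⨆ q : CStarSeminorm R, q.toSeminorm a := rfl

theorem le_norm (q : CStarSeminorm R) (a : PreUniversalCStar R) : q.toSeminorm a ≤ ‖a‖ :=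
  le_ciSup (CStarSeminorm.bddAbove R a) q

theorem norm_le {a : PreUniversalCStar R} {C : ℝ} (h : ∀ q : CStarSeminorm R, q.toSeminorm a ≤ C) :
    ‖a‖ ≤ C := ciSup_le h

protected theorem norm_nonneg' (a : PreUniversalCStar R) : 0 ≤ ‖a‖ :=
  (apply_nonneg (CStarSeminorm.zero R).toSeminorm a).trans (le_norm _ a)

variable (R) in
/-- The universal seminorm is a submultiplicative seminorm. -/
noncomputable def ringSeminorm : RingSeminorm (PreUniversalCStar R) where
  toFun a := ‖a‖
  map_zero' := le_antisymm (norm_le fun q => (map_zero q.toSeminorm).le)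
    (PreUniversalCStar.norm_nonneg' _)
  add_le' a b := norm_le fun q => (map_add_le_add q.toSeminorm a b).trans
    (add_le_add (le_norm q a) (le_norm q b))
  neg' a := congrArg iSup (funext fun q => map_neg_eq_map q.toSeminorm a)
  mul_le' a b := norm_le fun q => (q.mul_le' a b).trans
    (mul_le_mul (le_norm q a) (le_norm q b) (apply_nonneg q.toSeminorm b)
      (PreUniversalCStar.norm_nonneg' a))

noncomputable instance : SeminormedRing (PreUniversalCStar R) :=
  { (ringSeminorm R).toSeminormedRing with
    toRing := inferInstance
    norm := fun a => ‖a‖ }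

noncomputable instance : NormedAlgebra ℂ (PreUniversalCStar R) where
  norm_smul_le c a := norm_le fun q => by
    refine (map_smul_eq_mul q.toSeminorm c a).trans_le ?_
    exact mul_le_mul_of_nonneg_left (le_norm q a) (norm_nonneg c)

theorem norm_star' (a : PreUniversalCStar R) : ‖star a‖ = ‖a‖ :=
  congrArg iSup (funext fun q => q.star_eq a)

theorem norm_mul_self_le' (a : PreUniversalCStar R) : ‖a‖ * ‖a‖ ≤ ‖star a * a‖ := by
  have h : ‖a‖ ≤ √‖star a * a‖ := norm_le fun q => by
    refine Real.le_sqrt_of_sq_le ?_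
    have : q.toSeminorm (star a * a) = q.toSeminorm a ^ 2 := q.star_mul_self' a
    rw [← this]
    exact le_norm q (star a * a)
  calc ‖a‖ * ‖a‖ ≤ √‖star a * a‖ * √‖star a * a‖ := by gcongr
    _ = _ := Real.mul_self_sqrt (norm_nonneg _)

end PreUniversalCStar

/-- The universal unital C*-algebra generated by projections `p x`, `x : X`, subject to the
relations `r = 0` for `r ∈ R`: the (separated) completion of the noncommutative polynomials with
respect to the largest C*-seminorm for which these relations hold. -/
def UniversalCStar {X : Type*} (R : Set (StarPoly X)) : Type _ :=
  UniformSpace.Completion (PreUniversalCStar R)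

namespace UniversalCStar

open StarPoly UniformSpace

variable {X : Type*} {R : Set (StarPoly X)}

noncomputable instance : NormedRing (UniversalCStar R) :=
  inferInstanceAs (NormedRing (Completion (PreUniversalCStar R)))
noncomputable instance : Algebra ℂ (UniversalCStar R) :=
  inferInstanceAs (Algebra ℂ (Completion (PreUniversalCStar R)))
instance : CompleteSpace (UniversalCStar R) :=
  inferInstanceAs (CompleteSpace (Completion (PreUniversalCStar R)))

variable (R) in
/-- The canonical map from the noncommutative polynomials. -/
noncomputable def mk : StarPoly X →ₐ[ℂ] UniversalCStar R where
  toFun a := Completion.coe' (α := PreUniversalCStar R) a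
  map_one' := Completion.coe_one _
  map_mul' := Completion.coe_mul (α := PreUniversalCStar R)
  map_zero' := Completion.coe_zero
  map_add' := Completion.coe_add (α := PreUniversalCStar R)
  commutes' _ := rfl

theorem norm_mk (a : StarPoly X) : ‖mk R a‖ = ⨆ q : CStarSeminorm R, q.toSeminorm a :=
  Completion.norm_coe (E := PreUniversalCStar R) a

theorem denseRange_mk : DenseRange (mk R) :=
  Completion.denseRange_coe (α := PreUniversalCStar R)

theorem uniformContinuous_star_pre :
    UniformContinuous (star : PreUniversalCStar R → PreUniversalCStar R) :=
  (AddMonoidHomClass.isometry_of_norm (starAddEquiv : PreUniversalCStar R ≃+ _)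
    PreUniversalCStar.norm_star').uniformContinuous

noncomputable instance : Star (UniversalCStar R) where
  star := Completion.map (star : PreUniversalCStar R → PreUniversalCStar R)

theorem continuous_star' : Continuous (star : UniversalCStar R → UniversalCStar R) :=
  Completion.continuous_map

theorem star_mk (a : StarPoly X) : star (mk R a) = mk R (star a) :=
  Completion.map_coe uniformContinuous_star_pre (show PreUniversalCStar R from a)

noncomputable instance : StarRing (UniversalCStar R) where
  star_involutive a := by
    refine denseRange_mk.induction_on (p := fun a => star (star a) = a) a
      (isClosed_eq (continuous_star'.comp continuous_star') continuous_id) fun a => ?_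
    rw [star_mk, star_mk, star_star]
  star_mul a b := by
    refine denseRange_mk.induction_on₂ (p := fun a b => star (a * b) = star b * star a)
      (isClosed_eq (continuous_star'.comp continuous_mul)
        ((continuous_star'.comp continuous_snd).mul (continuous_star'.comp continuous_fst)))
      (fun a b => ?_) a b
    rw [← map_mul, star_mk, star_mk, star_mk, star_mul, map_mul]
  star_add a b := by
    refine denseRange_mk.induction_on₂ (p := fun a b => star (a + b) = star a + star b)
      (isClosed_eq (continuous_star'.comp continuous_add)
        ((continuous_star'.comp continuous_fst).add (continuous_star'.comp continuous_snd)))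
      (fun a b => ?_) a b
    rw [← map_add, star_mk, star_mk, star_mk, star_add, map_add]

noncomputable instance : NormedAlgebra ℂ (UniversalCStar R) where
  norm_smul_le := norm_smul_le (α := ℂ) (β := Completion (PreUniversalCStar R))

noncomputable instance : CStarAlgebra (UniversalCStar R) where
  star_smul c a := by
    refine denseRange_mk.induction_on (p := fun a => star (c • a) = star c • star a) a
      (isClosed_eq (continuous_star'.comp (continuous_const_smul c))
        (continuous_star'.const_smul (star c))) fun a => ?_
    rw [← map_smul, star_mk, star_mk, star_smul, map_smul]
  norm_mul_self_le a := by
    refine denseRange_mk.induction_on (p := fun a => ‖a‖ * ‖a‖ ≤ ‖star a * a‖) a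
      (isClosed_le (continuous_norm.mul continuous_norm)
        (continuous_norm.comp (continuous_star'.mul continuous_id))) fun a => ?_
    rw [star_mk, ← map_mul]
    exact (PreUniversalCStar.norm_mul_self_le' (R := R) a).trans_eq' (by rw [norm_mk]; rfl)
      |>.trans_eq (by rw [norm_mk]; rfl)

/-- The generating projections. -/
noncomputable def proj (x : X) : UniversalCStar R := mk R (gen x)

theorem mk_eq_eval (a : StarPoly X) : mk R a = eval (proj (R := R)) a := by
  induction a using StarPoly.induction_on with
  | hs c => simp
  | hg x => simp [proj]
  | ha a b iha ihb => simp [iha, ihb]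
  | hm a b iha ihb => simp [iha, ihb]

theorem isStarProjection_proj (x : X) : IsStarProjection (proj (R := R) x) where
  isIdempotentElem := by
    change mk R (gen x) * mk R (gen x) = mk R (gen x)
    rw [← sub_eq_zero, ← map_mul, ← map_sub, ← norm_eq_zero, norm_mk]
    exact (congrArg iSup (funext fun q => q.proj' x)).trans (by simp)
  isSelfAdjoint := by
    change star (mk R (gen x)) = mk R (gen x)
    rw [star_mk, star_gen]

theorem eval_proj_eq_zero {r : StarPoly X} (hr : r ∈ R) : eval (proj (R := R)) r = 0 := by
  rw [← mk_eq_eval, ← norm_eq_zero, norm_mk]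
  exact (congrArg iSup (funext fun q => q.rel' r hr)).trans (by simp)

/-- The universal property: a family of projections in a unital C*-algebra that satisfies the
relations extends uniquely to a unital `*`-homomorphism. -/
theorem existsUnique_lift {B : Type*} [CStarAlgebra B] (f : X → B)
    (hf : ∀ x, IsStarProjection (f x)) (hR : ∀ r ∈ R, eval f r = 0) :
    ∃! φ : UniversalCStar R →⋆ₐ[ℂ] B, ∀ x, φ (proj x) = f x := by
  have hbound : ∀ a : StarPoly X, ‖eval f a‖ ≤ ‖mk R a‖ := fun a => by
    rw [norm_mk]
    exact PreUniversalCStar.le_norm (CStarSeminorm.ofFamily f hf hR) a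
  let e : PreUniversalCStar R →+* B := (eval f : StarPoly X →ₐ[ℂ] B).toRingHom
  have hec : Continuous e := by
    refine AddMonoidHomClass.continuous_of_bound e 1 fun a => ?_
    rw [one_mul]
    exact (hbound a).trans_eq (norm_mk a)
  let ψ : UniversalCStar R →+* B := Completion.extensionHom e hec
  have hψc : Continuous ψ := Completion.continuous_extension
  have hψ : ∀ a, ψ (mk R a) = eval f a := fun a => Completion.extensionHom_coe e hec a
  refine ⟨{ ψ with
    commutes' := fun c => ?_
    map_star' := fun a => ?_ }, fun x => ?_, fun χ hχ => ?_⟩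
  · change ψ (algebraMap ℂ _ c) = _
    rw [← AlgHom.commutes (mk R), hψ, AlgHom.commutes]
  · change ψ (star a) = star (ψ a)
    refine denseRange_mk.induction_on (p := fun a => ψ (star a) = star (ψ a)) a
      (isClosed_eq (hψc.comp continuous_star') (continuous_star.comp hψc)) fun a => ?_
    rw [star_mk, hψ, hψ, eval_star f fun x => (hf x).isSelfAdjoint]
  · change ψ (mk R (gen x)) = f x
    rw [hψ, eval_gen]
  · have hχc : Continuous χ :=
      AddMonoidHomClass.continuous_of_bound χ 1 fun a => by
        simpa using NonUnitalStarAlgHom.norm_apply_le χ a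
    ext a
    change χ a = ψ a
    refine denseRange_mk.induction_on (p := fun a => χ a = ψ a) a
      (isClosed_eq hχc hψc) fun a => ?_
    rw [hψ]
    induction a using StarPoly.induction_on with
    | hs c => simp [AlgHomClass.commutes]
    | hg x => rw [eval_gen]; exact hχ x
    | ha a b iha ihb => simp [iha, ihb]
    | hm a b iha ihb => simp [iha, ihb]

end UniversalCStar

/-!
## Bipartite graphs and their C*-algebras
-/

/-- A bipartite graph with vertex classes `U` and `V` (disjoint by construction); `Adj u v` says
that `{u, v}` is an edge. -/
structure BipartiteGraph (U V : Type*) where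
  /-- The edge relation. -/
  Adj : U → V → Prop

namespace BipartiteGraph

variable {U V : Type*}

/-- The underlying simple graph on the disjoint union of the two vertex classes. -/
def toSimpleGraph (G : BipartiteGraph U V) : SimpleGraph (U ⊕ V) :=
  SimpleGraph.fromRel fun x y => ∃ u v, x = Sum.inl u ∧ y = Sum.inr v ∧ G.Adj u v

open StarPoly in
/-- The defining relations of the bipartite graph C*-algebra: the projections of each vertex class
sum up to `1`, and `p u * p v = 0` if `{u, v}` is not an edge. -/
def relations [Fintype U] [Fintype V] (G : BipartiteGraph U V) : Set (StarPoly (U ⊕ V)) :=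
  {∑ u : U, gen (Sum.inl u) - 1, ∑ v : V, gen (Sum.inr v) - 1} ∪
    {r | ∃ u v, ¬ G.Adj u v ∧ r = gen (Sum.inl u) * gen (Sum.inr v)}

/-- The bipartite graph C*-algebra `C*(G)`. -/
abbrev CStar [Fintype U] [Fintype V] (G : BipartiteGraph U V) : Type _ :=
  UniversalCStar G.relations

end BipartiteGraph

/-!
## Hypercubes
-/

/-- The vertices of the `n`-dimensional hypercube: sequences of `n` binary digits, where `x k` tells
whether the `k`-th binary digit is `1`. -/
abbrev HypercubeVertex (n : ℕ) : Type := Fin n → Bool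

namespace Hypercube

variable {n : ℕ}

/-- The number of binary digits equal to `1`. -/
def weight (x : HypercubeVertex n) : ℕ := (Finset.univ.filter fun k => x k = true).card

/-- Flip the `k`-th binary digit. -/
def flip (x : HypercubeVertex n) (k : Fin n) : HypercubeVertex n := Function.update x k (!x k)

/-- The vertices with an even number of ones. -/
abbrev EvenVertex (n : ℕ) : Type := {x : HypercubeVertex n // Even (weight x)}

/-- The vertices with an odd number of ones. -/
abbrev OddVertex (n : ℕ) : Type := {x : HypercubeVertex n // Odd (weight x)}

/-- The hypercube `Q_n` as a bipartite graph. -/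
def graph (n : ℕ) : BipartiteGraph (EvenVertex n) (OddVertex n) where
  Adj i j := ∃ k, flip i.1 k = j.1

/-- The subgraph `Q_n(t)`, obtained by removing all edges in directions `k` with `t k = 0`. -/
def graphAt (t : Fin n → ℝ) : BipartiteGraph (EvenVertex n) (OddVertex n) where
  Adj i j := (graph n).Adj i j ∧ ∀ k, flip i.1 k = j.1 → t k ≠ 0

/-- A matrix is in `t`-block diagonal form if its entries vanish at all pairs of indices which lie
in distinct connected components of `Q_n(t)`. -/
def IsBlockDiagonal (t : Fin n → ℝ) (A : Matrix (EvenVertex n) (EvenVertex n) ℂ) : Prop :=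
  ∀ i₁ i₂, ¬ (graphAt t).toSimpleGraph.Reachable (Sum.inl i₁) (Sum.inl i₂) → A i₁ i₂ = 0

theorem IsBlockDiagonal.algebraMap (t : Fin n → ℝ) (c : ℂ) :
    IsBlockDiagonal t (algebraMap ℂ (Matrix (EvenVertex n) (EvenVertex n) ℂ) c) := by
  intro i₁ i₂ h
  rw [Matrix.algebraMap_matrix_apply, if_neg]
  rintro rfl
  exact h (SimpleGraph.Reachable.refl _)

theorem IsBlockDiagonal.mul {t : Fin n → ℝ} {A B : Matrix (EvenVertex n) (EvenVertex n) ℂ}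
    (hA : IsBlockDiagonal t A) (hB : IsBlockDiagonal t B) : IsBlockDiagonal t (A * B) := by
  intro i₁ i₂ h
  rw [Matrix.mul_apply]
  refine Finset.sum_eq_zero fun j _ => ?_
  by_cases hj : (graphAt t).toSimpleGraph.Reachable (Sum.inl i₁) (Sum.inl j)
  · rw [hB j i₂ fun h' => h (hj.trans h'), mul_zero]
  · rw [hA i₁ j hj, zero_mul]

/-- The `*`-algebra, with pointwise operations, of continuous functions `f` from the standard
simplex `Δ_{n-1}` into the complex matrices indexed by the even vertices such that `f t` is in
`t`-block diagonal form for all `t`. -/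
def blockFunctions (n : ℕ) :
    StarSubalgebra ℂ C(stdSimplex ℝ (Fin n), Matrix (EvenVertex n) (EvenVertex n) ℂ) where
  carrier := {f | ∀ t : stdSimplex ℝ (Fin n), IsBlockDiagonal (t : Fin n → ℝ) (f t)}
  mul_mem' hf hg t := (hf t).mul (hg t)
  add_mem' {f g} hf hg t i₁ i₂ h := by
    change f t i₁ i₂ + g t i₁ i₂ = 0
    rw [hf t i₁ i₂ h, hg t i₁ i₂ h, add_zero]
  algebraMap_mem' c t := IsBlockDiagonal.algebraMap _ c
  star_mem' {f} hf t i₁ i₂ h := by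
    change star (f t i₂ i₁) = 0
    rw [hf t i₂ i₁ fun h' => h h'.symm, star_zero]

end Hypercube

/-!
## The algebra generated by two projections
-/

/-- The universal unital C*-algebra generated by two projections. -/
abbrev TwoProjectionsCStar : Type := UniversalCStar (∅ : Set (StarPoly (Fin 2)))

/-- The `*`-algebra of continuous functions from `[0, 1]` into the `2 × 2`-matrices that are
diagonal at both endpoints. -/
def pedersenAlgebra : StarSubalgebra ℂ C(unitInterval, Matrix (Fin 2) (Fin 2) ℂ) where
  carrier := {f | (f 0).IsDiag ∧ (f 1).IsDiag}
  mul_mem' {f g} hf hg := by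
    have key : ∀ A B : Matrix (Fin 2) (Fin 2) ℂ, A.IsDiag → B.IsDiag → (A * B).IsDiag := by
      intro A B hA hB
      rw [← hA.diagonal_diag, ← hB.diagonal_diag, Matrix.diagonal_mul_diagonal]
      exact Matrix.isDiag_diagonal _
    exact ⟨key _ _ hf.1 hg.1, key _ _ hf.2 hg.2⟩
  add_mem' hf hg := ⟨hf.1.add hg.1, hf.2.add hg.2⟩
  algebraMap_mem' c := by
    have key : (algebraMap ℂ (Matrix (Fin 2) (Fin 2) ℂ) c).IsDiag := by
      rw [Matrix.algebraMap_eq_diagonal]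
      exact Matrix.isDiag_diagonal _
    exact ⟨key, key⟩
  star_mem' hf := ⟨hf.1.conjTranspose, hf.2.conjTranspose⟩

/-!
The projections of `C*(Q_n)` are indexed by the vertices `x` of the hypercube; write `P x` for them.
Opposite corners `x`, `z` of a square belong to the same vertex class, so `P x * P z = 0`. Expanding
this product over the common neighbours of `x` and `z` shows that the two paths from `x` to `z`
yield products of projections that are negatives of each other (`IsCubeFamily.mul_mul_square`).
Signs on the edges whose product around every square is `-1` (`Hypercube.sgn`) turn this into
invariance: the signed product along a path (`Hypercube.pathProd`) only depends on its start and on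
how often each direction occurs (`IsCubeFamily.pathProd_perm`).

Consequently the sums `coord P k` of the loops `P x * P (flip x k) * P x` over the even vertices are
central; they are positive and add up to `1`. By Gelfand duality for the centre they define a
homomorphism `ψ` from `C(Δ)` to the centre (`exists_starAlgHom_simplex`), and by path invariance
the corner of any polynomial at an even vertex `y` has the form `ψ g * P y` (`exists_corner_eq`).

On the other side, the weighted signed adjacency matrix `∑ √(t k) γ_k`, with anticommuting signed
permutations `γ_k`, squares to `∑ t k = 1` (`sum_adjEntry_mul_adjEntry`). Its rows at the odd
vertices form an orthonormal basis next to the standard basis indexed by the even vertices, and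
the projections onto the vectors of both bases give a representation on matrix-valued functions on
the simplex. It maps `ψ g` to the scalar function `g`, so it is isometric on the corners at the even
vertices and therefore injective (`representation_injective`). Its range is closed and contains
`g · ∏ √(t k)` in the matrix entry `(i, j)` for all `g`, where `k` runs through the digits in which
`i` and `j` differ. The `(i, j)`-entries of block diagonal functions vanish at the zeros of this
product, so they belong to the closed ideal that it generates, and the range consists of all block
diagonal functions (`mem_range_representation`).

The square is a complete bipartite graph with two vertices in each class, so its algebra is
generated by two projections without further relations; the one-dimensional simplex is the unit
interval, and a direction is removed exactly at its endpoints.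
-/

open Matrix

/-! ### Combinatorics of the hypercube -/

namespace Hypercube

variable {n : ℕ}

theorem flip_apply (x : HypercubeVertex n) (k l : Fin n) :
    flip x k l = if l = k then !x k else x l := by
  simp [flip, Function.update_apply]

@[simp] theorem flip_flip (x : HypercubeVertex n) (k : Fin n) : flip (flip x k) k = x := by
  funext l
  simp only [flip_apply]
  grind

theorem flip_comm (x : HypercubeVertex n) (k l : Fin n) :
    flip (flip x k) l = flip (flip x l) k := by
  funext m
  simp only [flip_apply]
  grind

theorem flip_injective (x : HypercubeVertex n) : Function.Injective (flip x) := by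
  intro k l h
  have := congrFun h k
  simp only [flip_apply] at this
  grind

theorem weight_flip_add (x : HypercubeVertex n) (k : Fin n) :
    weight (flip x k) + (if x k then 1 else 0) = weight x + (if x k then 0 else 1) := by
  have key : ∀ y : HypercubeVertex n, weight y =
      (if y k then 1 else 0) + ∑ l ∈ Finset.univ.erase k, if y l then 1 else 0 := by
    intro y
    rw [weight, Finset.card_filter]
    exact (Finset.add_sum_erase _ _ (Finset.mem_univ k)).symm
  have h : ∑ l ∈ Finset.univ.erase k, (if flip x k l then 1 else 0) =
      ∑ l ∈ Finset.univ.erase k, if x l then 1 else 0 := by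
    refine Finset.sum_congr rfl fun l hl => ?_
    rw [flip_apply, if_neg (Finset.ne_of_mem_erase hl)]
  rw [key x, key (flip x k), h, flip_apply]
  cases x k <;> simp [add_comm]

theorem even_weight_flip (x : HypercubeVertex n) (k : Fin n) :
    Even (weight (flip x k)) ↔ ¬ Even (weight x) := by
  have := weight_flip_add x k
  split_ifs at this <;> grind

/-- If `z` arises from `x` by flipping the digits `k ≠ l`, then `flip x k` and `flip x l` are the only
common neighbours of `x` and `z`. -/
theorem eq_or_eq_of_flip_flip {x : HypercubeVertex n} {k l m m' : Fin n} (hkl : k ≠ l)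
    (h : flip (flip x m) m' = flip (flip x k) l) : m = k ∨ m = l := by
  by_contra! hm
  have h1 := congrFun h m
  have h2 := congrFun h k
  have h3 := congrFun h l
  simp only [flip_apply] at h1 h2 h3
  grind

theorem flip_flip_ne {x : HypercubeVertex n} {k l : Fin n} (hkl : k ≠ l) :
    flip (flip x k) l ≠ x := by
  intro h
  have := congrFun h k
  simp only [flip_apply] at this
  grind

theorem adj_iff {i : EvenVertex n} {j : OddVertex n} :
    (graph n).Adj i j ↔ ∃ k, flip i.1 k = j.1 := Iff.rfl

/-- The sign of the edge at `x` in direction `k`: minus one to the power of the number of ones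
before the `k`-th digit. The signs around every square of the hypercube multiply to `-1`. -/
noncomputable def sgn (x : HypercubeVertex n) (k : Fin n) : ℂ :=
  ∏ l ∈ Finset.Iio k, if x l then -1 else 1

theorem sgn_mul_self (x : HypercubeVertex n) (k : Fin n) : sgn x k * sgn x k = 1 := by
  rw [sgn, ← Finset.prod_mul_distrib]
  exact Finset.prod_eq_one fun l _ => by split_ifs <;> norm_num

@[simp] theorem star_sgn (x : HypercubeVertex n) (k : Fin n) : star (sgn x k) = sgn x k := by
  rw [sgn, star_prod]
  exact Finset.prod_congr rfl fun l _ => by split_ifs <;> simp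

theorem sgn_ne_zero (x : HypercubeVertex n) (k : Fin n) : sgn x k ≠ 0 := by
  intro h
  simpa [h] using sgn_mul_self x k

theorem sgn_flip_of_le (x : HypercubeVertex n) {k l : Fin n} (h : l ≤ k) :
    sgn (flip x k) l = sgn x l := by
  refine Finset.prod_congr rfl fun m hm => ?_
  have hmk : m ≠ k := ((Finset.mem_Iio.1 hm).trans_le h).ne
  rw [flip_apply, if_neg hmk]

theorem sgn_flip_of_lt (x : HypercubeVertex n) {k l : Fin n} (h : k < l) :
    sgn (flip x k) l = -sgn x l := by
  have hk : k ∈ Finset.Iio l := by simpa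
  rw [sgn, sgn, ← Finset.mul_prod_erase _ _ hk, ← Finset.mul_prod_erase _ _ hk, ← neg_mul]
  congr 1
  · rw [flip_apply, if_pos rfl]
    cases x k <;> simp
  · refine Finset.prod_congr rfl fun m hm => ?_
    rw [flip_apply, if_neg (Finset.ne_of_mem_erase hm)]

@[simp] theorem sgn_flip_self (x : HypercubeVertex n) (k : Fin n) : sgn (flip x k) k = sgn x k :=
  sgn_flip_of_le x le_rfl

theorem sgn_square (x : HypercubeVertex n) {k l : Fin n} (h : k ≠ l) :
    sgn x k * sgn (flip x k) l = -(sgn x l * sgn (flip x l) k) := by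
  rcases h.lt_or_gt with h | h
  · rw [sgn_flip_of_lt x h, sgn_flip_of_le x h.le]; ring
  · rw [sgn_flip_of_lt x h, sgn_flip_of_le x h.le]; ring

/-- The endpoint `L.foldl flip x` of the path that starts at `x` and has the directions `L`. -/
theorem foldl_flip_apply (x : HypercubeVertex n) (L : List (Fin n)) (k : Fin n) :
    L.foldl flip x k = xor (x k) (decide (Odd (L.count k))) := by
  induction L generalizing x with
  | nil => simp
  | cons l L ih =>
    rw [List.foldl_cons, ih, flip_apply, List.count_cons]
    by_cases h : l = k
    · subst h
      by_cases h' : Odd (L.count l) <;> cases x l <;> simp [h', Nat.odd_add_one]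
    · simp [h, Ne.symm h]

theorem foldl_flip_perm (x : HypercubeVertex n) {L L' : List (Fin n)} (h : L.Perm L') :
    L.foldl flip x = L'.foldl flip x := by
  funext k
  rw [foldl_flip_apply, foldl_flip_apply, h.count_eq]

/-- Flipping the digits in which `x` and `y` differ leads from `x` to `y`. -/
theorem foldl_flip_filter_ne (x y : HypercubeVertex n) :
    (Finset.univ.filter fun k => x k ≠ y k).toList.foldl flip x = y := by
  funext k
  rw [foldl_flip_apply, (Finset.nodup_toList _).count]
  by_cases h : x k = y k
  · simp [h]
  · rw [if_pos (by simpa using h)]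
    revert h
    cases x k <;> cases y k <;> simp

end Hypercube

/-! ### Projections and star homomorphisms in C*-algebras -/

section Projections

variable {A : Type*} [CStarAlgebra A]

theorem eq_zero_of_sum_star_mul_self_eq_zero {ι : Type*} [Fintype ι] {a : ι → A}
    (h : ∑ i, star (a i) * a i = 0) (i : ι) : a i = 0 := by
  let _ := CStarAlgebra.spectralOrder A
  let _ := CStarAlgebra.spectralOrderedRing A
  rw [Finset.sum_eq_zero_iff_of_nonneg fun i _ => star_mul_self_nonneg (a i)] at h
  exact CStarRing.star_mul_self_eq_zero_iff _ |>.1 (h i (Finset.mem_univ i))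

/-- Projections that sum up to `1` are mutually orthogonal. -/
theorem IsStarProjection.mul_eq_zero_of_sum_eq_one {ι : Type*} [Fintype ι] {p : ι → A}
    (hp : ∀ i, IsStarProjection (p i)) (h : ∑ i, p i = 1) {i j : ι} (hij : i ≠ j) :
    p i * p j = 0 := by
  classical
  -- The squares of the `p i * p j` with `i ≠ j` sum up to `p j * 1 * p j - p j = 0`.
  let a : ι → A := fun i => if i = j then 0 else p i * p j
  have ha : ∑ i, star (a i) * a i = 0 := by
    have h1 : ∑ i, p j * p i * p j = p j := by
      rw [← Finset.sum_mul, ← Finset.mul_sum, h, mul_one, (hp j).isIdempotentElem.eq]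
    have h2 : ∀ i, star (a i) * a i = p j * p i * p j - if i = j then p j else 0 := by
      intro i
      by_cases hi : i = j
      · subst hi
        simp [a, (hp i).isIdempotentElem.eq]
      · simp only [a, hi, if_false, star_mul, (hp _).isSelfAdjoint.star_eq, sub_zero]
        rw [mul_assoc, ← mul_assoc (p i), (hp i).isIdempotentElem.eq, mul_assoc]
    rw [Finset.sum_congr rfl fun i _ => h2 i, Finset.sum_sub_distrib, h1]
    simp
  simpa [a, hij] using eq_zero_of_sum_star_mul_self_eq_zero ha i

/-- Star homomorphisms between C*-algebras are continuous, because they are contractive. -/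
theorem StarAlgHom.continuous_of_cstarAlgebra {A B : Type*} [CStarAlgebra A] [CStarAlgebra B]
    (φ : A →⋆ₐ[ℂ] B) : Continuous φ :=
  AddMonoidHomClass.continuous_of_bound φ 1 fun a => by
    simpa using NonUnitalStarAlgHom.norm_apply_le φ a

end Projections

/-! ### Path products of projections indexed by the hypercube -/

namespace Hypercube

variable {n : ℕ} {A : Type*} [CStarAlgebra A]

/-- A family of projections indexed by all vertices of the hypercube that satisfies the defining
relations of `C*(Q_n)`. -/
structure IsCubeFamily (P : HypercubeVertex n → A) : Prop where
  proj : ∀ x, IsStarProjection (P x)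
  sum_even : ∑ x : EvenVertex n, P x = 1
  sum_odd : ∑ x : OddVertex n, P x = 1
  mul_eq_zero_of_not_adj : ∀ (i : EvenVertex n) (j : OddVertex n),
    ¬ (graph n).Adj i j → P i * P j = 0

/-- The signed product of the projections along the path that starts at `x` and has the
directions `L`. -/
noncomputable def pathProd (P : HypercubeVertex n → A) :
    HypercubeVertex n → List (Fin n) → A
  | x, [] => P x
  | x, k :: L => sgn x k • (P x * pathProd P (flip x k) L)

/-- The `k`-th coordinate function of the simplex as an element of the C*-algebra: the sum of the
loops `P x * P (flip x k) * P x` over the even vertices. -/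
noncomputable def coord (P : HypercubeVertex n → A) (k : Fin n) : A :=
  ∑ x : EvenVertex n, P x * P (flip x k) * P x

namespace IsCubeFamily

variable {P : HypercubeVertex n → A}

theorem mul_self (hP : IsCubeFamily P) (x : HypercubeVertex n) : P x * P x = P x :=
  (hP.proj x).isIdempotentElem.eq

theorem star_eq (hP : IsCubeFamily P) (x : HypercubeVertex n) : star (P x) = P x :=
  (hP.proj x).isSelfAdjoint.star_eq

theorem mul_self_assoc (hP : IsCubeFamily P) (x : HypercubeVertex n) (a : A) :
    P x * (P x * a) = P x * a := by
  rw [← mul_assoc, hP.mul_self]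

/-- The projections of distinct vertices that are not adjacent are orthogonal, whatever the classes
of the vertices. -/
theorem mul_eq_zero (hP : IsCubeFamily P) {x y : HypercubeVertex n} (hxy : x ≠ y)
    (h : ∀ k, flip x k ≠ y) : P x * P y = 0 := by
  have hp : ∀ x y : HypercubeVertex n, (∀ k, flip x k ≠ y) → Even (weight x) → Odd (weight y) →
      P x * P y = 0 := fun x y h hx hy =>
    hP.mul_eq_zero_of_not_adj ⟨x, hx⟩ ⟨y, hy⟩ fun ⟨k, hk⟩ => h k hk
  rcases Nat.even_or_odd (weight x) with hx | hx <;> rcases Nat.even_or_odd (weight y) with hy | hy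
  · exact IsStarProjection.mul_eq_zero_of_sum_eq_one (p := fun x : EvenVertex n => P x)
      (fun x => hP.proj x) hP.sum_even (i := ⟨x, hx⟩) (j := ⟨y, hy⟩) (by simpa using hxy)
  · exact hp x y h hx hy
  · have := hp y x (fun k hk => h k (by rw [← hk, flip_flip])) hy hx
    simpa [hP.star_eq] using congrArg star this
  · exact IsStarProjection.mul_eq_zero_of_sum_eq_one (p := fun x : OddVertex n => P x)
      (fun x => hP.proj x) hP.sum_odd (i := ⟨x, hx⟩) (j := ⟨y, hy⟩) (by simpa using hxy)

theorem mul_eq_zero_of_even (hP : IsCubeFamily P) {x y : HypercubeVertex n} (hxy : x ≠ y)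
    (h : Even (weight x) ↔ Even (weight y)) : P x * P y = 0 :=
  hP.mul_eq_zero hxy fun k hk => by
    have := even_weight_flip x k
    rw [hk] at this
    tauto

/-- Each vertex projection is the sum of the steps to its neighbours. -/
theorem sum_mul_flip (hP : IsCubeFamily P) (x : HypercubeVertex n) :
    ∑ k, P x * P (flip x k) = P x := by
  -- Here `p` describes the vertex class to which `x` does not belong.
  have key : ∀ (p : HypercubeVertex n → Prop) [DecidablePred p], (∀ k, p (flip x k)) →
      (∀ y, p y → y ≠ x) → ∑ y : {y // p y}, P y = 1 → ∑ k, P x * P (flip x k) = P x := by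
    intro p _ hp hx hs
    have h : P x * ∑ y : {y // p y}, P y = P x := by rw [hs, mul_one]
    refine Eq.trans ?_ h
    rw [Finset.mul_sum]
    refine Finset.sum_of_injOn (fun k => ⟨flip x k, hp k⟩)
      (fun k _ l _ hkl => flip_injective x (congrArg Subtype.val hkl)) (by simp)
      (fun y _ hy => hP.mul_eq_zero (hx y.1 y.2).symm fun k hk => hy ?_) (by simp)
    exact ⟨k, by simp, Subtype.ext hk⟩
  by_cases hx : Even (weight x)
  · exact key (fun y => Odd (weight y))
      (fun k => by rw [← Nat.not_even_iff_odd, even_weight_flip]; tauto)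
      (fun y hy h => by rw [h, ← Nat.not_even_iff_odd] at hy; exact hy hx) hP.sum_odd
  · exact key (fun y => Even (weight y)) (fun k => (even_weight_flip x k).2 hx)
      (fun y hy h => hx (h ▸ hy)) hP.sum_even

/-- The two paths along a square of the hypercube are negatives of each other, because their sum is
the product of the orthogonal projections at opposite corners. -/
theorem mul_mul_square (hP : IsCubeFamily P) (x : HypercubeVertex n) {k l : Fin n} (h : k ≠ l) :
    P x * (P (flip x k) * P (flip (flip x k) l)) =
      -(P x * (P (flip x l) * P (flip (flip x l) k))) := by
  have h0 : P x * P (flip (flip x k) l) = 0 :=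
    hP.mul_eq_zero_of_even (flip_flip_ne h).symm (by simp [even_weight_flip])
  have h1 := congrArg (· * P (flip (flip x k) l)) (hP.sum_mul_flip x)
  simp only [h0, Finset.sum_mul] at h1
  rw [Fintype.sum_eq_add k l h] at h1
  · rw [flip_comm x l k, ← mul_assoc, ← mul_assoc]
    exact eq_neg_of_add_eq_zero_left h1
  · rintro m ⟨hk, hl⟩
    rw [mul_assoc, hP.mul_eq_zero (x := flip x m), mul_zero]
    · intro hm
      have h1 := even_weight_flip x m
      have h2 := even_weight_flip x k
      have h3 := even_weight_flip (flip x k) l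
      rw [hm] at h1
      tauto
    · intro m' hm'
      rcases eq_or_eq_of_flip_flip h hm' with rfl | rfl
      exacts [hk rfl, hl rfl]

theorem mul_pathProd (hP : IsCubeFamily P) (x : HypercubeVertex n) (L : List (Fin n)) :
    P x * pathProd P x L = pathProd P x L := by
  cases L with
  | nil => exact hP.mul_self x
  | cons k L => rw [pathProd, mul_smul_comm, hP.mul_self_assoc]

/-- The signed product along a path only depends on its start and on how often it uses each
direction: the signs are chosen such that they compensate those of `mul_mul_square`. -/
theorem pathProd_perm (hP : IsCubeFamily P) (x : HypercubeVertex n) {L L' : List (Fin n)}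
    (h : L.Perm L') : pathProd P x L = pathProd P x L' := by
  induction h generalizing x with
  | nil => rfl
  | cons k _ ih => rw [pathProd, pathProd, ih]
  | trans _ _ ih₁ ih₂ => rw [ih₁, ih₂]
  | swap k l L =>
    by_cases hkl : k = l
    · rw [hkl]
    simp only [pathProd, mul_smul_comm, smul_smul]
    have key : ∀ a, P x * (P (flip x k) * (P (flip (flip x k) l) * a)) =
        -(P x * (P (flip x l) * (P (flip (flip x l) k) * a))) := fun a => by
      simpa only [mul_assoc, neg_mul] using congrArg (· * a) (hP.mul_mul_square x hkl)
    rw [← hP.mul_pathProd (flip (flip x l) k), ← hP.mul_pathProd (flip (flip x k) l), key,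
      sgn_square x hkl, flip_comm x l k, neg_smul_neg]

theorem pathProd_append (hP : IsCubeFamily P) (x : HypercubeVertex n) (L L' : List (Fin n)) :
    pathProd P x (L ++ L') = pathProd P x L * pathProd P (L.foldl flip x) L' := by
  induction L generalizing x with
  | nil => exact (hP.mul_pathProd x L').symm
  | cons k L ih => simp [pathProd, ih, mul_assoc]

theorem pathProd_mul (hP : IsCubeFamily P) (x : HypercubeVertex n) (L : List (Fin n)) :
    pathProd P x L * P (L.foldl flip x) = pathProd P x L := by
  simpa [pathProd] using (hP.pathProd_append x L []).symm

theorem pathProd_append_singleton (hP : IsCubeFamily P) (x : HypercubeVertex n)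
    (L : List (Fin n)) (k : Fin n) : pathProd P x (L ++ [k]) =
      sgn (L.foldl flip x) k • (pathProd P x L * P (flip (L.foldl flip x) k)) := by
  rw [hP.pathProd_append, pathProd, pathProd, mul_smul_comm, ← mul_assoc, hP.pathProd_mul]

/-- Multiplying a path with a vertex projection gives zero or a multiple of a path that ends at
this vertex. -/
theorem pathProd_mul_eq (hP : IsCubeFamily P) (x y : HypercubeVertex n) (L : List (Fin n)) :
    pathProd P x L * P y = 0 ∨
      ∃ (c : ℂ) (L' : List (Fin n)), L'.foldl flip x = y ∧ pathProd P x L * P y =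
        c • pathProd P x L' := by
  by_cases h : L.foldl flip x = y
  · exact .inr ⟨1, L, h, by rw [← h, hP.pathProd_mul, one_smul]⟩
  by_cases h' : ∃ k, flip (L.foldl flip x) k = y
  · obtain ⟨k, rfl⟩ := h'
    refine .inr ⟨sgn (L.foldl flip x) k, L ++ [k], by simp, ?_⟩
    rw [hP.pathProd_append_singleton, smul_smul, sgn_mul_self, one_smul]
  · left
    rw [← hP.pathProd_mul, mul_assoc, hP.mul_eq_zero h (by simpa using h'), mul_zero]

theorem mul_coord_of_even (hP : IsCubeFamily P) {x : HypercubeVertex n} (hx : Even (weight x))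
    (k : Fin n) : P x * coord P k = P x * P (flip x k) * P x := by
  rw [coord, Finset.mul_sum, Fintype.sum_eq_single ⟨x, hx⟩]
  · simp only [mul_assoc, hP.mul_self_assoc]
  · intro y hy
    rw [← mul_assoc, ← mul_assoc, hP.mul_eq_zero_of_even (fun h => hy (Subtype.ext h.symm))
      (by simp [hx, y.2])]
    simp

/-- The description of `coord P k` is symmetric in the two vertex classes: its corner at an odd
vertex is the loop at this vertex, too. -/
theorem mul_coord (hP : IsCubeFamily P) (x : HypercubeVertex n) (k : Fin n) :
    P x * coord P k = P x * P (flip x k) * P x := by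
  by_cases hx : Even (weight x)
  · exact hP.mul_coord_of_even hx k
  -- Expand over the even neighbours of `x` and move the loop in direction `k` to the front.
  have key : ∀ l, P x * P (flip x l) * coord P k =
      P x * P (flip x k) * P x * (P x * P (flip x l)) := by
    intro l
    have h := hP.pathProd_perm x (L := [l, k, k]) (L' := [k, k, l])
      (by rw [List.perm_iff_count]; intro a; simp [List.count_cons]; ring)
    simp only [pathProd, flip_flip, mul_smul_comm, smul_smul, sgn_flip_self] at h
    rw [← mul_assoc (sgn x k), sgn_mul_self x k, one_mul, sgn_mul_self, mul_one] at h
    have h' := smul_right_injective A (sgn_ne_zero x l) h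
    rw [mul_assoc, hP.mul_coord_of_even ((even_weight_flip x l).2 hx)]
    simpa only [mul_assoc, hP.mul_self_assoc] using h'
  calc P x * coord P k = (∑ l, P x * P (flip x l)) * coord P k := by rw [hP.sum_mul_flip]
    _ = P x * P (flip x k) * P x * ∑ l, P x * P (flip x l) := by
      rw [Finset.sum_mul, Finset.mul_sum]
      exact Finset.sum_congr rfl fun l _ => key l
    _ = _ := by rw [hP.sum_mul_flip, mul_assoc, hP.mul_self]

theorem star_coord (hP : IsCubeFamily P) (k : Fin n) : star (coord P k) = coord P k := by
  simp [coord, star_sum, hP.star_eq, mul_assoc]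

theorem commute_coord (hP : IsCubeFamily P) (x : HypercubeVertex n) (k : Fin n) :
    Commute (P x) (coord P k) := by
  have h := hP.mul_coord x k
  have h' := congrArg star h
  simp only [star_mul, hP.star_coord, hP.star_eq] at h'
  rw [Commute, SemiconjBy, h, h', mul_assoc]

theorem sum_coord (hP : IsCubeFamily P) : ∑ k, coord P k = 1 := by
  simp only [coord]
  rw [Finset.sum_comm, ← hP.sum_even]
  refine Finset.sum_congr rfl fun x _ => ?_
  rw [← Finset.sum_mul, hP.sum_mul_flip, hP.mul_self]

/-- The coordinate elements are sums of elements of the form `star a * a`. -/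
theorem coord_eq_sum_star_mul_self (hP : IsCubeFamily P) (k : Fin n) :
    coord P k = ∑ x : EvenVertex n, star (P (flip x k) * P x) * (P (flip x k) * P x) := by
  refine Finset.sum_congr rfl fun x _ => ?_
  rw [star_mul, hP.star_eq, hP.star_eq, mul_assoc, mul_assoc, hP.mul_self_assoc]

theorem pathProd_cons_cons (hP : IsCubeFamily P) (x : HypercubeVertex n) (k : Fin n)
    (L : List (Fin n)) : pathProd P x (k :: k :: L) = coord P k * pathProd P x L := by
  simp only [pathProd, flip_flip, mul_smul_comm, smul_smul, sgn_flip_self, sgn_mul_self, one_smul]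
  rw [← hP.mul_pathProd x L, ← mul_assoc, ← mul_assoc, ← mul_assoc (coord P k),
    ← (hP.commute_coord x k).eq, hP.mul_coord]

/-- A closed path is a monomial in the coordinate elements times the projection at its start. -/
theorem pathProd_closed (hP : IsCubeFamily P) (x : HypercubeVertex n) (L : List (Fin n))
    (hL : L.foldl flip x = x) :
    ∃ M : List (Fin n), pathProd P x L = (M.map (coord P)).prod * P x := by
  induction h : L.length using Nat.strong_induction_on generalizing L with
  | _ m ih =>
    cases L with
    | nil => exact ⟨[], by simp [pathProd]⟩
    | cons k L =>
      -- Since the path is closed, the direction `k` occurs an even number of times.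
      have hk : k ∈ L := by
        have := congrFun hL k
        rw [foldl_flip_apply, List.count_cons_self] at this
        by_contra hk
        simp [List.count_eq_zero_of_not_mem hk] at this
      have hp : (k :: L).Perm (k :: k :: L.erase k) := (List.perm_cons_erase hk).cons k
      have hlen := hp.length_eq
      have hL' : (L.erase k).foldl flip x = x := by
        rw [foldl_flip_perm x hp] at hL
        simpa using hL
      obtain ⟨M, hM⟩ := ih _ (by simp only [List.length_cons] at hlen h ⊢; omega) _ hL' rfl
      exact ⟨k :: M, by rw [hP.pathProd_perm x hp, hP.pathProd_cons_cons, hM]; simp [mul_assoc]⟩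

end IsCubeFamily
end Hypercube

/-! ### Functions on the simplex in the centre of a C*-algebra -/

section Simplex

open scoped ComplexOrder

variable {n : ℕ} {A : Type*} [CStarAlgebra A]

/-- The `k`-th barycentric coordinate as a complex-valued function on the standard simplex. -/
noncomputable def simplexCoord (k : Fin n) : C(stdSimplex ℝ (Fin n), ℂ) where
  toFun t := (t k : ℂ)
  continuous_toFun := Complex.continuous_ofReal.comp
    ((continuous_apply k).comp continuous_subtype_val)

@[simp] theorem simplexCoord_apply (k : Fin n) (t : stdSimplex ℝ (Fin n)) :
    simplexCoord k t = (t k : ℂ) := rfl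

/-- The Stone–Weierstrass theorem for the simplex and its coordinate functions. -/
theorem topologicalClosure_adjoin_simplexCoord :
    (StarAlgebra.adjoin ℂ (Set.range (simplexCoord (n := n)))).topologicalClosure = ⊤ := by
  refine ContinuousMap.starSubalgebra_topologicalClosure_eq_top_of_separatesPoints _ ?_
  intro s t hst
  obtain ⟨k, hk⟩ := Function.ne_iff.1 fun h => hst (Subtype.ext h)
  exact ⟨simplexCoord k, ⟨_, StarAlgebra.subset_adjoin _ _ ⟨k, rfl⟩, rfl⟩,
    fun h => hk (Complex.ofReal_injective h)⟩

/-- Star homomorphisms out of the continuous functions on the simplex are determined by their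
values on the coordinate functions. -/
theorem starAlgHom_ext_simplexCoord {φ ψ : C(stdSimplex ℝ (Fin n), ℂ) →⋆ₐ[ℂ] A}
    (h : ∀ k, φ (simplexCoord k) = ψ (simplexCoord k)) : φ = ψ := by
  have hle : (StarAlgebra.adjoin ℂ (Set.range (simplexCoord (n := n)))).topologicalClosure ≤
      StarAlgHom.equalizer φ ψ := by
    refine StarSubalgebra.topologicalClosure_minimal ?_
      (isClosed_eq φ.continuous_of_cstarAlgebra ψ.continuous_of_cstarAlgebra)
    rw [StarAlgebra.adjoin_le_iff]
    rintro _ ⟨k, rfl⟩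
    exact h k
  rw [topologicalClosure_adjoin_simplexCoord] at hle
  exact StarAlgHom.ext fun a => hle (StarSubalgebra.mem_top (x := a))

/-- Functional calculus on the simplex: central elements `h k` that are positive and sum up to `1`
define a homomorphism from the continuous functions on the simplex to the centre. It is the
pullback along the map that sends a character of the centre to its values at the `h k`. -/
theorem exists_starAlgHom_simplex (h : Fin n → A) (hcomm : ∀ k a, Commute (h k) a)
    (hpos : ∀ k, ∃ (ι : Type) (_ : Fintype ι) (a : ι → A), h k = ∑ i, star (a i) * a i)
    (hsum : ∑ k, h k = 1) :
    ∃ ψ : C(stdSimplex ℝ (Fin n), ℂ) →⋆ₐ[ℂ] A,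
      (∀ k, ψ (simplexCoord k) = h k) ∧ ∀ g a, Commute (ψ g) a := by
  let Z : StarSubalgebra ℂ A := StarSubalgebra.centralizer ℂ Set.univ
  have hZ : ∀ z, z ∈ Z ↔ ∀ a, a * z = z * a := by
    intro z
    rw [StarSubalgebra.mem_centralizer_iff]
    exact ⟨fun H a => (H a trivial).1, fun H a _ => ⟨H a, H _⟩⟩
  have hclosed : IsClosed (Z : Set A) := by
    rw [StarSubalgebra.coe_centralizer]
    exact Set.isClosed_centralizer _
  let _ : CommCStarAlgebra Z :=
    { (inferInstance : CStarAlgebra Z) with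
      mul_comm := fun a b => Subtype.ext ((hZ b).1 b.2 a) }
  let z : Fin n → Z := fun k => ⟨h k, (hZ _).2 fun a => ((hcomm k a).eq).symm⟩
  have hspec : ∀ k (χ : WeakDual.characterSpace ℂ Z), 0 ≤ χ (z k) := by
    intro k χ
    have h1 : χ (z k) ∈ spectrum ℂ (h k) := by
      rw [← StarSubalgebra.spectrum_eq (S := Z) (a := z k)]
      exact AlgHom.apply_mem_spectrum χ (z k)
    obtain ⟨ι, _, a, ha⟩ := hpos k
    let _ := CStarAlgebra.spectralOrder A
    let _ := CStarAlgebra.spectralOrderedRing A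
    refine spectrum_nonneg_of_nonneg (a := h k) ?_ h1
    rw [ha]
    exact Finset.sum_nonneg fun i _ => star_mul_self_nonneg (a i)
  have hmem : ∀ χ : WeakDual.characterSpace ℂ Z,
      (fun k => (χ (z k)).re) ∈ stdSimplex ℝ (Fin n) := by
    intro χ
    refine ⟨fun k => ?_, ?_⟩
    · exact (Complex.nonneg_iff.1 (hspec k χ)).1
    · have h1 : ∑ k, z k = 1 := Subtype.ext (by simpa [z] using hsum)
      have h2 := congrArg (fun a => (χ a).re) h1
      simpa using h2
  let q : C(WeakDual.characterSpace ℂ Z, stdSimplex ℝ (Fin n)) :=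
    ⟨fun χ => ⟨_, hmem χ⟩, by
      refine Continuous.subtype_mk (continuous_pi fun k => Complex.continuous_re.comp ?_) _
      exact (WeakDual.gelfandTransform ℂ Z (z k)).continuous⟩
  let ψ : C(stdSimplex ℝ (Fin n), ℂ) →⋆ₐ[ℂ] A :=
    Z.subtype.comp (((gelfandStarTransform Z).symm : _ →⋆ₐ[ℂ] Z).comp (q.compStarAlgHom' ℂ ℂ))
  refine ⟨ψ, fun k => ?_, fun g a => ((hZ _).1 (Subtype.coe_prop _) a).symm⟩
  have : (gelfandStarTransform Z).symm (q.compStarAlgHom' ℂ ℂ (simplexCoord k)) = z k := by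
    rw [StarAlgEquiv.symm_apply_eq]
    ext χ
    exact (Complex.eq_re_of_ofReal_le (r := 0) (by simpa using hspec k χ)).symm
  exact congrArg Subtype.val this

end Simplex

/-! ### The representation by matrix-valued functions -/

/-- Membership in the simplex for the coercion to functions. -/
theorem stdSimplex_coe_mem {n : ℕ} (t : stdSimplex ℝ (Fin n)) : ⇑t ∈ stdSimplex ℝ (Fin n) := t.2

namespace Hypercube

variable {n : ℕ}

/-- The entries of the weighted and signed adjacency matrix of the hypercube, where the edges in
direction `k` have weight `√(t k)`. -/
noncomputable def adjEntry (t : Fin n → ℝ) (x y : HypercubeVertex n) : ℂ :=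
  ∑ k, if flip x k = y then sgn x k * (√(t k) : ℂ) else 0

theorem adjEntry_flip (t : Fin n → ℝ) (x : HypercubeVertex n) (k : Fin n) :
    adjEntry t x (flip x k) = sgn x k * (√(t k) : ℂ) := by
  rw [adjEntry, Finset.sum_eq_single k]
  · simp
  · intro l _ hl
    rw [if_neg fun h => hl (flip_injective x h)]
  · simp

theorem adjEntry_eq_zero (t : Fin n → ℝ) {x y : HypercubeVertex n} (h : ∀ k, flip x k ≠ y) :
    adjEntry t x y = 0 :=
  Finset.sum_eq_zero fun k _ => if_neg (h k)

theorem adjEntry_comm (t : Fin n → ℝ) (x y : HypercubeVertex n) :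
    adjEntry t x y = adjEntry t y x := by
  by_cases h : ∃ k, flip x k = y
  · obtain ⟨k, rfl⟩ := h
    have := adjEntry_flip t (flip x k) k
    rw [flip_flip, sgn_flip_self] at this
    rw [this, adjEntry_flip]
  · push Not at h
    rw [adjEntry_eq_zero t h, adjEntry_eq_zero t fun k hk => h k (by rw [← hk, flip_flip])]

theorem star_adjEntry (t : Fin n → ℝ) (x y : HypercubeVertex n) :
    star (adjEntry t x y) = adjEntry t x y := by
  rw [adjEntry, star_sum]
  refine Finset.sum_congr rfl fun k _ => ?_
  split_ifs
  · rw [star_mul', star_sgn, Complex.star_def, Complex.conj_ofReal]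
  · simp

theorem sum_adjEntry_mul (t : Fin n → ℝ) (x : HypercubeVertex n) (f : HypercubeVertex n → ℂ)
    (p : HypercubeVertex n → Prop) [DecidablePred p] (hp : ∀ k, p (flip x k)) :
    ∑ y : {y // p y}, adjEntry t x y * f y = ∑ k, sgn x k * (√(t k) : ℂ) * f (flip x k) := by
  symm
  refine Finset.sum_of_injOn (fun k => ⟨flip x k, hp k⟩)
    (fun k _ l _ hkl => flip_injective x (congrArg Subtype.val hkl)) (by simp)
    (fun y _ hy => ?_) (fun k _ => by rw [adjEntry_flip])
  rw [adjEntry_eq_zero t fun k hk => hy ⟨k, by simp, Subtype.ext hk⟩, zero_mul]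

/-- The weighted and signed adjacency matrix of the hypercube squares to `1`: its diagonal entries
are `∑ k, t k = 1`, and the two terms of any other entry cancel. -/
theorem sum_adjEntry_mul_adjEntry {t : Fin n → ℝ} (ht : t ∈ stdSimplex ℝ (Fin n))
    (x z : HypercubeVertex n) (p : HypercubeVertex n → Prop) [DecidablePred p]
    (hp : ∀ k, p (flip x k)) :
    ∑ y : {y // p y}, adjEntry t x y * adjEntry t z y = if x = z then 1 else 0 := by
  rw [sum_adjEntry_mul t x (adjEntry t z) p hp]
  split_ifs with h
  · subst h
    rw [← Complex.ofReal_one, ← ht.2, Complex.ofReal_sum]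
    refine Finset.sum_congr rfl fun k _ => ?_
    rw [adjEntry_flip, mul_mul_mul_comm, sgn_mul_self, one_mul, ← Complex.ofReal_mul,
      Real.mul_self_sqrt (ht.1 k)]
  -- The rows overlap only if `x` and `z` are opposite corners of a square.
  by_cases hz : ∃ k l, flip z l = flip x k
  · obtain ⟨k, l, hkl⟩ := hz
    obtain rfl : z = flip (flip x k) l := by rw [← hkl, flip_flip]
    have hne : k ≠ l := by
      rintro rfl
      exact h (flip_flip x k).symm
    rw [Fintype.sum_eq_add k l hne]
    · have h1 := adjEntry_flip t (flip (flip x k) l) l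
      have h2 := adjEntry_flip t (flip (flip x l) k) k
      rw [flip_flip, sgn_flip_self] at h1 h2
      rw [h1, flip_comm x k l, h2]
      have := sgn_square x hne
      linear_combination (√(t k) : ℂ) * (√(t l) : ℂ) * this
    · rintro m ⟨hk, hl⟩
      rw [adjEntry_eq_zero, mul_zero]
      intro m' hm'
      have : flip (flip x m) m' = flip (flip x k) l := by rw [← hm', flip_flip]
      rcases eq_or_eq_of_flip_flip hne this with rfl | rfl
      exacts [hk rfl, hl rfl]
  · push Not at hz
    exact Finset.sum_eq_zero fun k _ => by rw [adjEntry_eq_zero t (hz k), mul_zero]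

/-- The unit vector that spans the range of the projection of the vertex `x` in the representation
at the point `t` of the simplex: a standard basis vector if `x` is even, a row of the weighted and
signed adjacency matrix if `x` is odd. -/
noncomputable def vertexVec (t : Fin n → ℝ) (x : HypercubeVertex n) (i : EvenVertex n) : ℂ :=
  if Even (weight x) then (if i.1 = x then 1 else 0) else adjEntry t x i

theorem vertexVec_even (t : Fin n → ℝ) (x : EvenVertex n) :
    vertexVec t x = Pi.single x 1 := by
  funext i
  simp [vertexVec, x.2, Pi.single_apply, Subtype.ext_iff]

theorem vertexVec_of_not_even (t : Fin n → ℝ) {x : HypercubeVertex n} (hx : ¬ Even (weight x))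
    (i : EvenVertex n) : vertexVec t x i = adjEntry t x i := if_neg hx

theorem star_vertexVec (t : Fin n → ℝ) (x : HypercubeVertex n) :
    star (vertexVec t x) = vertexVec t x := by
  funext i
  simp only [vertexVec, Pi.star_apply]
  split_ifs <;> simp [star_adjEntry]

theorem vertexVec_dotProduct_self {t : Fin n → ℝ} (ht : t ∈ stdSimplex ℝ (Fin n))
    (x : HypercubeVertex n) : vertexVec t x ⬝ᵥ vertexVec t x = 1 := by
  by_cases hx : Even (weight x)
  · rw [vertexVec_even t ⟨x, hx⟩]
    simp
  · simp only [dotProduct, vertexVec_of_not_even t hx]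
    rw [sum_adjEntry_mul_adjEntry ht x x (fun y => Even (weight y))
      fun k => (even_weight_flip x k).2 hx, if_pos rfl]

theorem vertexVec_dotProduct_even (t : Fin n → ℝ) {x y : HypercubeVertex n}
    (hx : Even (weight x)) (hy : ¬ Even (weight y)) :
    vertexVec t x ⬝ᵥ vertexVec t y = adjEntry t x y := by
  rw [vertexVec_even t ⟨x, hx⟩, single_dotProduct, vertexVec_of_not_even t hy, one_mul,
    adjEntry_comm]

theorem vertexVec_dotProduct_flip (t : Fin n → ℝ) (x : HypercubeVertex n) (k : Fin n) :
    vertexVec t x ⬝ᵥ vertexVec t (flip x k) = sgn x k * (√(t k) : ℂ) := by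
  rw [← adjEntry_flip]
  by_cases hx : Even (weight x)
  · exact vertexVec_dotProduct_even t hx (by rw [even_weight_flip]; simpa using hx)
  · rw [dotProduct_comm, vertexVec_dotProduct_even t ((even_weight_flip x k).2 hx) hx,
      adjEntry_comm]

theorem continuous_vertexVec (x : HypercubeVertex n) (i : EvenVertex n) :
    Continuous fun t : stdSimplex ℝ (Fin n) => vertexVec t x i := by
  simp only [vertexVec]
  split_ifs
  · exact continuous_const
  · exact continuous_const
  · refine continuous_finsetSum _ fun k _ => ?_
    split_ifs
    · exact continuous_const.mul (Complex.continuous_ofReal.comp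
        (Real.continuous_sqrt.comp ((continuous_apply k).comp continuous_subtype_val)))
    · exact continuous_const

/-- The projection-valued function on the simplex that belongs to the vertex `x`. -/
noncomputable def vertexFun (x : HypercubeVertex n) :
    C(stdSimplex ℝ (Fin n), Matrix (EvenVertex n) (EvenVertex n) ℂ) where
  toFun t := vecMulVec (vertexVec t x) (vertexVec t x)
  continuous_toFun := continuous_matrix fun i j =>
    (continuous_vertexVec x i).mul (continuous_vertexVec x j)

@[simp] theorem vertexFun_apply (x : HypercubeVertex n) (t : stdSimplex ℝ (Fin n)) :
    vertexFun x t = vecMulVec (vertexVec t x) (vertexVec t x) := rfl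

open scoped Matrix.Norms.L2Operator

theorem isCubeFamily_vertexFun : IsCubeFamily (vertexFun (n := n)) where
  proj x := by
    constructor
    · ext t i j
      change (vertexFun x t * vertexFun x t) i j = _
      rw [vertexFun_apply, vecMulVec_mul_vecMulVec,
        vertexVec_dotProduct_self (stdSimplex_coe_mem t), one_smul]
    · ext t i j
      change star (vertexFun x t) i j = _
      rw [vertexFun_apply, star_eq_conjTranspose, conjTranspose_vecMulVec, star_vertexVec]
  sum_even := by
    ext t i j
    rw [ContinuousMap.sum_apply, Matrix.sum_apply]
    simp [vertexVec_even, vecMulVec_apply, Pi.single_apply, Matrix.one_apply]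
  sum_odd := by
    ext t i j
    rw [ContinuousMap.sum_apply, Matrix.sum_apply]
    have h := sum_adjEntry_mul_adjEntry (stdSimplex_coe_mem t) i.1 j.1 (fun y => Odd (weight y))
      fun k => by rw [← Nat.not_even_iff_odd, even_weight_flip]; simpa using i.2
    rw [ContinuousMap.one_apply, Matrix.one_apply]
    simp only [Subtype.ext_iff]
    rw [← h]
    refine Finset.sum_congr rfl fun y _ => ?_
    have hy := Nat.not_even_iff_odd.2 y.2
    rw [vertexFun_apply, vecMulVec_apply, vertexVec_of_not_even _ hy, vertexVec_of_not_even _ hy,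
      adjEntry_comm, adjEntry_comm _ y.1]
  mul_eq_zero_of_not_adj i j h := by
    ext t a b
    change (vertexFun i t * vertexFun j t) a b = 0
    rw [vertexFun_apply, vertexFun_apply, vecMulVec_mul_vecMulVec,
      vertexVec_dotProduct_even _ i.2 (Nat.not_even_iff_odd.2 j.2),
      adjEntry_eq_zero _ fun k hk => h ⟨k, hk⟩]
    simp

theorem pathProd_vertexFun (x : HypercubeVertex n) (L : List (Fin n))
    (t : stdSimplex ℝ (Fin n)) : pathProd vertexFun x L t =
      (L.map fun k => (√(t k) : ℂ)).prod •
        vecMulVec (vertexVec t x) (vertexVec t (L.foldl flip x)) := by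
  induction L generalizing x with
  | nil => simp [pathProd]
  | cons k L ih =>
    rw [pathProd]
    change sgn x k • (vertexFun x t * pathProd vertexFun (flip x k) L t) = _
    rw [ih, vertexFun_apply, mul_smul_comm, vecMulVec_mul_vecMulVec, vertexVec_dotProduct_flip]
    ext i j
    simp [vecMulVec_apply]
    linear_combination (√(t k) : ℂ) * (L.map fun k => (√(t k) : ℂ)).prod * vertexVec t x i *
      vertexVec t (L.foldl flip (flip x k)) j * sgn_mul_self x k

theorem coord_vertexFun (k : Fin n) (t : stdSimplex ℝ (Fin n)) :
    coord vertexFun k t = algebraMap ℂ _ (t k : ℂ) := by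
  rw [coord, ContinuousMap.sum_apply]
  have h : ∀ x : EvenVertex n, (vertexFun x.1 * vertexFun (flip x k) * vertexFun x.1 :
      C(stdSimplex ℝ (Fin n), Matrix (EvenVertex n) (EvenVertex n) ℂ)) t =
      (t k : ℂ) • vertexFun x.1 t := by
    intro x
    have h := pathProd_vertexFun x.1 [k, k] t
    simp only [pathProd, flip_flip, mul_smul_comm, smul_smul, sgn_flip_self, sgn_mul_self,
      one_smul] at h
    rw [mul_assoc, h]
    simp only [List.map_cons, List.map_nil, List.prod_cons, List.prod_nil, mul_one,
      List.foldl_cons, List.foldl_nil, flip_flip, vertexFun_apply]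
    rw [← Complex.ofReal_mul, Real.mul_self_sqrt ((stdSimplex_coe_mem t).1 k)]
  rw [Finset.sum_congr rfl fun x _ => h x, ← Finset.smul_sum, ← ContinuousMap.sum_apply,
    isCubeFamily_vertexFun.sum_even, Algebra.algebraMap_eq_smul_one]
  rfl

end Hypercube

namespace Hypercube

variable {n : ℕ}

/-! ### The generators of `C*(Q_n)` and its representation -/

/-- The generating projection of `C*(Q_n)` that belongs to a vertex. -/
noncomputable def vertexProj (x : HypercubeVertex n) : (graph n).CStar :=
  if h : Even (weight x) then UniversalCStar.proj (Sum.inl ⟨x, h⟩)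
  else UniversalCStar.proj (Sum.inr ⟨x, Nat.not_even_iff_odd.1 h⟩)

theorem vertexProj_even (x : EvenVertex n) :
    vertexProj x.1 = UniversalCStar.proj (R := (graph n).relations) (Sum.inl x) := dif_pos x.2

theorem vertexProj_odd (x : OddVertex n) :
    vertexProj x.1 = UniversalCStar.proj (R := (graph n).relations) (Sum.inr x) :=
  dif_neg (Nat.not_even_iff_odd.2 x.2)

theorem isCubeFamily_vertexProj : IsCubeFamily (vertexProj (n := n)) where
  proj x := by
    rw [vertexProj]
    split_ifs <;> exact UniversalCStar.isStarProjection_proj _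
  sum_even := by
    have h := UniversalCStar.eval_proj_eq_zero (R := (graph n).relations)
      (r := ∑ u, StarPoly.gen (Sum.inl u) - 1) (by simp [BipartiteGraph.relations])
    simpa [vertexProj_even, sub_eq_zero] using h
  sum_odd := by
    have h := UniversalCStar.eval_proj_eq_zero (R := (graph n).relations)
      (r := ∑ u, StarPoly.gen (Sum.inr u) - 1) (by simp [BipartiteGraph.relations])
    simpa [vertexProj_odd, sub_eq_zero] using h
  mul_eq_zero_of_not_adj i j hij := by
    have h := UniversalCStar.eval_proj_eq_zero (R := (graph n).relations)
      (r := StarPoly.gen (Sum.inl i) * StarPoly.gen (Sum.inr j)) (.inr ⟨i, j, hij, rfl⟩)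
    simpa [vertexProj_even, vertexProj_odd] using h

open scoped Matrix.Norms.L2Operator

/-- The representation of `C*(Q_n)` on matrix-valued functions. -/
theorem exists_representation : ∃ φ : (graph n).CStar →⋆ₐ[ℂ]
    C(stdSimplex ℝ (Fin n), Matrix (EvenVertex n) (EvenVertex n) ℂ),
    ∀ x, φ (vertexProj x) = vertexFun x := by
  have hV := isCubeFamily_vertexFun (n := n)
  obtain ⟨φ, hφ, -⟩ := UniversalCStar.existsUnique_lift (R := (graph n).relations)
    (Sum.elim (fun u => vertexFun u.1) fun v => vertexFun v.1)
    (by rintro (u | v) <;> exact hV.proj _) (by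
      rintro r ((rfl | rfl) | ⟨u, v, huv, rfl⟩)
      · simp [hV.sum_even]
      · simp [hV.sum_odd]
      · simpa using hV.mul_eq_zero_of_not_adj u v huv)
  refine ⟨φ, fun x => ?_⟩
  rw [vertexProj]
  split_ifs <;> exact hφ _

end Hypercube

namespace UniversalCStar

variable {X : Type*} {R : Set (StarPoly X)}

/-- The universal C*-algebra is generated by its generating projections. -/
theorem mem_of_proj_mem {S : StarSubalgebra ℂ (UniversalCStar R)}
    (hS : IsClosed (S : Set (UniversalCStar R))) (h : ∀ x, proj x ∈ S) (a : UniversalCStar R) :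
    a ∈ S := by
  refine denseRange_mk.induction_on (p := fun a => a ∈ S) a hS fun a => ?_
  induction a using StarPoly.induction_on with
  | hs c => rw [AlgHom.commutes]; exact S.algebraMap_mem c
  | hg x => exact h x
  | ha a b iha ihb => rw [map_add]; exact add_mem iha ihb
  | hm a b iha ihb => rw [map_mul]; exact mul_mem iha ihb

end UniversalCStar

namespace Hypercube

variable {n : ℕ}

theorem mem_of_vertexProj_mem {S : StarSubalgebra ℂ (graph n).CStar}
    (hS : IsClosed (S : Set (graph n).CStar)) (h : ∀ x, vertexProj x ∈ S) (a : (graph n).CStar) :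
    a ∈ S := by
  refine UniversalCStar.mem_of_proj_mem hS ?_ a
  rintro (x | x)
  · exact vertexProj_even x ▸ h x
  · exact vertexProj_odd x ▸ h x

/-- The action of the continuous functions on the simplex by central elements of `C*(Q_n)`. -/
theorem exists_central_functions : ∃ ψ : C(stdSimplex ℝ (Fin n), ℂ) →⋆ₐ[ℂ] (graph n).CStar,
    (∀ k, ψ (simplexCoord k) = coord vertexProj k) ∧ ∀ g a, Commute (ψ g) a := by
  have hP := isCubeFamily_vertexProj (n := n)
  refine exists_starAlgHom_simplex _ (fun k a => ?_)
    (fun k => ⟨_, inferInstance, _, hP.coord_eq_sum_star_mul_self k⟩) hP.sum_coord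
  have h : a ∈ StarSubalgebra.centralizer ℂ {coord (vertexProj (n := n)) k} := by
    refine mem_of_vertexProj_mem ?_ (fun x => ?_) a
    · rw [StarSubalgebra.coe_centralizer]
      exact Set.isClosed_centralizer _
    · simp [StarSubalgebra.mem_centralizer_iff, hP.star_coord, (hP.commute_coord x k).eq]
  exact ((StarSubalgebra.mem_centralizer_iff _).1 h _ rfl).1

/-- The polynomials in the generators are linear combinations of signed products along paths that
start at even vertices. -/
theorem mk_mem_span_pathProd (a : StarPoly (EvenVertex n ⊕ OddVertex n)) :
    UniversalCStar.mk (graph n).relations a ∈ Submodule.span ℂ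
      (Set.range fun p : EvenVertex n × List (Fin n) => pathProd vertexProj p.1.1 p.2) := by
  have hP := isCubeFamily_vertexProj (n := n)
  set W := Submodule.span ℂ
    (Set.range fun p : EvenVertex n × List (Fin n) => pathProd (vertexProj (n := n)) p.1.1 p.2)
  have hsub : ∀ (x : EvenVertex n) L, pathProd vertexProj x.1 L ∈ W :=
    fun x L => Submodule.subset_span ⟨(x, L), rfl⟩
  have hvertex : ∀ y, ∀ w ∈ W, w * vertexProj y ∈ W := by
    intro y w hw
    induction hw using Submodule.span_induction with
    | mem w hw =>
      obtain ⟨⟨x, L⟩, rfl⟩ := hw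
      rcases hP.pathProd_mul_eq x.1 y L with h | ⟨c, L', -, h⟩
      · simp only [h, zero_mem]
      · simp only [h]
        exact W.smul_mem c (hsub x L')
    | zero => simp
    | add v w _ _ hv hw => rw [add_mul]; exact add_mem hv hw
    | smul c w _ hw => rw [smul_mul_assoc]; exact W.smul_mem c hw
  -- `W` contains `1` and is invariant under right multiplication by polynomials.
  have hmul : ∀ w ∈ W, w * UniversalCStar.mk (graph n).relations a ∈ W := by
    induction a using StarPoly.induction_on with
    | hs c =>
      intro w hw
      rw [AlgHom.commutes, ← Algebra.commutes, ← Algebra.smul_def]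
      exact W.smul_mem c hw
    | hg x =>
      rcases x with x | x
      · exact fun w hw => (vertexProj_even x).subst (motive := fun p => w * p ∈ W) (hvertex x w hw)
      · exact fun w hw => (vertexProj_odd x).subst (motive := fun p => w * p ∈ W) (hvertex x w hw)
    | ha a b iha ihb =>
      intro w hw
      rw [map_add, mul_add]
      exact add_mem (iha w hw) (ihb w hw)
    | hm a b iha ihb =>
      intro w hw
      rw [map_mul, ← mul_assoc]
      exact ihb _ (iha w hw)
  have h1 : (1 : (graph n).CStar) ∈ W := by
    rw [← hP.sum_even]
    exact sum_mem fun x _ => hsub x []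
  simpa using hmul 1 h1

/-- The corner of a polynomial at an even vertex `y` is a function on the simplex times the
projection of `y`. -/
theorem exists_corner_eq {ψ : C(stdSimplex ℝ (Fin n), ℂ) →⋆ₐ[ℂ] (graph n).CStar}
    (hψ : ∀ k, ψ (simplexCoord k) = coord vertexProj k) (y : EvenVertex n)
    (a : StarPoly (EvenVertex n ⊕ OddVertex n)) :
    ∃ g, vertexProj y.1 * UniversalCStar.mk (graph n).relations a * vertexProj y.1 =
      ψ g * vertexProj y.1 := by
  have hP := isCubeFamily_vertexProj (n := n)
  have hspan := mk_mem_span_pathProd a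
  generalize UniversalCStar.mk (graph n).relations a = w at hspan ⊢
  induction hspan using Submodule.span_induction with
  | mem w hw =>
    obtain ⟨⟨x, L⟩, rfl⟩ := hw
    by_cases hxy : y.1 = x.1
    · simp only [← hxy, hP.mul_pathProd]
      rcases hP.pathProd_mul_eq y.1 y.1 L with h | ⟨c, L', hL', h⟩
      · exact ⟨0, by simp [h]⟩
      · obtain ⟨M, hM⟩ := hP.pathProd_closed y.1 L' hL'
        refine ⟨c • (M.map simplexCoord).prod, ?_⟩
        rw [h, hM, map_smul, map_list_prod, List.map_map, smul_mul_assoc]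
        simp only [Function.comp_def, hψ]
    · refine ⟨0, ?_⟩
      simp only
      rw [← hP.mul_pathProd, ← mul_assoc, hP.mul_eq_zero_of_even hxy (by simp [x.2, y.2])]
      simp
  | zero => exact ⟨0, by simp⟩
  | add v w _ _ hv hw =>
    obtain ⟨g, hg⟩ := hv
    obtain ⟨g', hg'⟩ := hw
    exact ⟨g + g', by rw [mul_add, add_mul, hg, hg', map_add, add_mul]⟩
  | smul c w _ hw =>
    obtain ⟨g, hg⟩ := hw
    exact ⟨c • g, by rw [mul_smul_comm, smul_mul_assoc, hg, map_smul, smul_mul_assoc]⟩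

/-! ### Injectivity of the representation -/

open scoped Matrix.Norms.L2Operator

/-- The representation maps central functions to scalar functions. -/
theorem representation_central {φ : (graph n).CStar →⋆ₐ[ℂ]
    C(stdSimplex ℝ (Fin n), Matrix (EvenVertex n) (EvenVertex n) ℂ)}
    (hφ : ∀ x, φ (vertexProj x) = vertexFun x)
    {ψ : C(stdSimplex ℝ (Fin n), ℂ) →⋆ₐ[ℂ] (graph n).CStar}
    (hψ : ∀ k, ψ (simplexCoord k) = coord vertexProj k)
    (g : C(stdSimplex ℝ (Fin n), ℂ)) (t : stdSimplex ℝ (Fin n)) :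
    φ (ψ g) t = algebraMap ℂ _ (g t) := by
  let χ : C(stdSimplex ℝ (Fin n), ℂ) →⋆ₐ[ℂ]
      C(stdSimplex ℝ (Fin n), Matrix (EvenVertex n) (EvenVertex n) ℂ) :=
    ContinuousMap.compStarAlgHom _ (StarAlgHom.ofId ℂ _) (continuous_algebraMap ℂ _)
  have h : φ.comp ψ = χ := by
    refine starAlgHom_ext_simplexCoord fun k => ?_
    ext1 t
    rw [StarAlgHom.comp_apply, hψ, coord, map_sum]
    simp only [map_mul, hφ]
    exact coord_vertexFun k t
  exact congrArg (fun f => f t) (DFunLike.congr_fun h g)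

theorem representation_pathProd {φ : (graph n).CStar →⋆ₐ[ℂ]
    C(stdSimplex ℝ (Fin n), Matrix (EvenVertex n) (EvenVertex n) ℂ)}
    (hφ : ∀ x, φ (vertexProj x) = vertexFun x) (x : HypercubeVertex n) (L : List (Fin n)) :
    φ (pathProd vertexProj x L) = pathProd vertexFun x L := by
  induction L generalizing x with
  | nil => exact hφ x
  | cons k L ih => simp only [pathProd, map_smul, map_mul, hφ, ih]

/-- The representation is injective: if it kills `a`, then it kills the corners of `star a * a` at
the even vertices, on which it is isometric because they are functions on the simplex times the
projection of the vertex. Hence `a` times each even projection is zero. -/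
theorem representation_injective {φ : (graph n).CStar →⋆ₐ[ℂ]
    C(stdSimplex ℝ (Fin n), Matrix (EvenVertex n) (EvenVertex n) ℂ)}
    (hφ : ∀ x, φ (vertexProj x) = vertexFun x) : Function.Injective φ := by
  have hP := isCubeFamily_vertexProj (n := n)
  obtain ⟨ψ, hψ, -⟩ := exists_central_functions (n := n)
  have hφc := φ.continuous_of_cstarAlgebra
  -- The representation does not decrease the norm on the corner of an even vertex.
  have hcorner : ∀ (y : EvenVertex n) (a : (graph n).CStar),
      ‖vertexProj y.1 * a * vertexProj y.1‖ ≤ ‖φ (vertexProj y.1 * a * vertexProj y.1)‖ := by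
    intro y a
    have hc : Continuous fun a => vertexProj y.1 * a * vertexProj y.1 :=
      (continuous_const.mul continuous_id).mul continuous_const
    refine UniversalCStar.denseRange_mk.induction_on (p := fun a =>
      ‖vertexProj y.1 * a * vertexProj y.1‖ ≤ ‖φ (vertexProj y.1 * a * vertexProj y.1)‖) a
      (isClosed_le hc.norm (hφc.comp hc).norm) fun a => ?_
    obtain ⟨g, hg⟩ := exists_corner_eq hψ y a
    rw [hg]
    have h1 : ‖ψ g * vertexProj y.1‖ ≤ ‖g‖ := by
      refine (norm_mul_le _ _).trans ?_
      exact (mul_le_of_le_one_right (norm_nonneg _) (hP.proj y.1).norm_le).trans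
        (NonUnitalStarAlgHom.norm_apply_le ψ g)
    refine h1.trans ((ContinuousMap.norm_le _ (norm_nonneg _)).2 fun t => ?_)
    have h2 : φ (ψ g * vertexProj y.1) t = diagonal (Pi.single y (g t)) := by
      rw [map_mul, hφ]
      change φ (ψ g) t * vertexFun y.1 t = _
      rw [representation_central hφ hψ, vertexFun_apply, vertexVec_even, ← Algebra.smul_def]
      ext i j
      simp [vecMulVec_apply, diagonal_apply, Pi.single_apply]
      grind
    calc ‖g t‖ = ‖(diagonal (Pi.single y (g t)) : Matrix (EvenVertex n) (EvenVertex n) ℂ)‖ := by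
          rw [l2_opNorm_diagonal, Pi.norm_single]
      _ ≤ _ := by rw [← h2]; exact ContinuousMap.norm_coe_le_norm _ t
  rw [injective_iff_map_eq_zero]
  intro a ha
  have h0 : ∀ y : EvenVertex n, a * vertexProj y.1 = 0 := by
    intro y
    have h1 := hcorner y (star a * a)
    rw [map_mul, map_mul, map_mul, ha, mul_zero, mul_zero, zero_mul, norm_zero] at h1
    rw [← CStarRing.star_mul_self_eq_zero_iff, star_mul, hP.star_eq]
    simpa only [mul_assoc, norm_le_zero_iff] using h1
  rw [← mul_one a, ← hP.sum_even, Finset.mul_sum]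
  exact Finset.sum_eq_zero fun y _ => h0 y

/-! ### Block diagonal functions -/

/-- Connected vertices agree in the digits whose directions are removed. -/
theorem reachable_coord_eq {t : Fin n → ℝ} {k : Fin n} (hk : t k = 0) {i j : EvenVertex n}
    (h : (graphAt t).toSimpleGraph.Reachable (Sum.inl i) (Sum.inl j)) : i.1 k = j.1 k := by
  let c : EvenVertex n ⊕ OddVertex n → Bool := Sum.elim (fun u => u.1 k) fun v => v.1 k
  have hedge : ∀ u v, (graphAt t).Adj u v → u.1 k = v.1 k := by
    rintro u v ⟨⟨l, hl⟩, h⟩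
    have hlk : k ≠ l := fun h' => h l hl (h' ▸ hk)
    rw [← hl, flip_apply, if_neg hlk]
  have hadj : ∀ x y, (graphAt t).toSimpleGraph.Adj x y → c x = c y := by
    rintro x y ⟨-, ⟨u, v, rfl, rfl, h⟩ | ⟨u, v, rfl, rfl, h⟩⟩
    · exact hedge u v h
    · exact (hedge u v h).symm
  obtain ⟨w⟩ := h
  suffices ∀ x y, (graphAt t).toSimpleGraph.Walk x y → c x = c y from this _ _ w
  intro x y w
  induction w with
  | nil => rfl
  | cons h _ ih => exact (hadj _ _ h).trans ih

theorem adj_of_adjEntry_ne_zero {t : Fin n → ℝ} (v : OddVertex n) {i : EvenVertex n}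
    (h : adjEntry t v.1 i.1 ≠ 0) : (graphAt t).toSimpleGraph.Adj (Sum.inl i) (Sum.inr v) := by
  have hex : ∃ k, flip v.1 k = i.1 := by
    by_contra! hk
    exact h (adjEntry_eq_zero t hk)
  obtain ⟨k, hk⟩ := hex
  rw [← hk, adjEntry_flip] at h
  have hki : flip i.1 k = v.1 := by rw [← hk, flip_flip]
  refine ⟨by simp, .inl ⟨i, v, rfl, rfl, ⟨k, hki⟩, fun l hl h0 => h ?_⟩⟩
  rw [flip_injective i.1 (hki.trans hl.symm), h0]
  simp

theorem vertexFun_mem_blockFunctions (x : HypercubeVertex n) : vertexFun x ∈ blockFunctions n := by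
  intro t i j hij
  rw [vertexFun_apply, vecMulVec_apply]
  by_cases hx : Even (weight x)
  · rw [vertexVec_even _ ⟨x, hx⟩]
    by_contra h
    have h1 := left_ne_zero_of_mul h
    have h2 := right_ne_zero_of_mul h
    simp only [Pi.single_apply, ne_eq, ite_eq_right_iff, one_ne_zero, imp_false, not_not] at h1 h2
    exact hij (by rw [h1, h2])
  · rw [vertexVec_of_not_even _ hx, vertexVec_of_not_even _ hx]
    by_contra h
    have h1 := adj_of_adjEntry_ne_zero ⟨x, Nat.not_even_iff_odd.1 hx⟩ (left_ne_zero_of_mul h)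
    have h2 := adj_of_adjEntry_ne_zero ⟨x, Nat.not_even_iff_odd.1 hx⟩ (right_ne_zero_of_mul h)
    exact hij (h1.reachable.trans h2.symm.reachable)

theorem isClosed_blockFunctions : IsClosed (blockFunctions n :
    Set C(stdSimplex ℝ (Fin n), Matrix (EvenVertex n) (EvenVertex n) ℂ)) := by
  have : (blockFunctions n : Set C(stdSimplex ℝ (Fin n), Matrix (EvenVertex n) (EvenVertex n) ℂ)) =
      ⋂ (t : stdSimplex ℝ (Fin n)) (i : EvenVertex n) (j : EvenVertex n)
        (_ : ¬ (graphAt t).toSimpleGraph.Reachable (Sum.inl i) (Sum.inl j)), {f | f t i j = 0} := by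
    ext f
    simp only [Set.mem_iInter]
    rfl
  rw [this]
  refine isClosed_iInter fun t => isClosed_iInter fun i => isClosed_iInter fun j =>
    isClosed_iInter fun _ => isClosed_eq ?_ continuous_const
  exact (continuous_apply_apply (ρ := fun _ _ => ℂ) i j).comp (continuous_eval_const t)

theorem representation_mem_blockFunctions {φ : (graph n).CStar →⋆ₐ[ℂ]
    C(stdSimplex ℝ (Fin n), Matrix (EvenVertex n) (EvenVertex n) ℂ)}
    (hφ : ∀ x, φ (vertexProj x) = vertexFun x) (a : (graph n).CStar) :
    φ a ∈ blockFunctions n := by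
  have hφc := φ.continuous_of_cstarAlgebra
  refine mem_of_vertexProj_mem (S := (blockFunctions n).comap φ)
    (isClosed_blockFunctions.preimage hφc) (fun x => ?_) a
  rw [StarSubalgebra.mem_comap, hφ]
  exact vertexFun_mem_blockFunctions x

/-- The function with a single matrix entry. -/
noncomputable def singleFun (i j : EvenVertex n) (g : C(stdSimplex ℝ (Fin n), ℂ)) :
    C(stdSimplex ℝ (Fin n), Matrix (EvenVertex n) (EvenVertex n) ℂ) :=
  ContinuousMap.comp ⟨fun c => Matrix.single i j c, continuous_matrix fun a b => by
    simp only [Matrix.single_apply]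
    split_ifs <;> fun_prop⟩ g

theorem continuous_singleFun (i j : EvenVertex n) : Continuous (singleFun i j) :=
  ContinuousMap.continuous_postcomp _

/-- Every block diagonal function is in the range of the representation. The path from `i` to `j`
yields the function with the single entry `∏ √(t k)`, where `k` runs through the digits in which
`i` and `j` differ, and the `(i, j)`-entries of block diagonal functions lie in the closed ideal
that is generated by this product, because they vanish at its zeros. -/
theorem mem_range_representation {φ : (graph n).CStar →⋆ₐ[ℂ]
    C(stdSimplex ℝ (Fin n), Matrix (EvenVertex n) (EvenVertex n) ℂ)}
    (hφ : ∀ x, φ (vertexProj x) = vertexFun x)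
    {f : C(stdSimplex ℝ (Fin n), Matrix (EvenVertex n) (EvenVertex n) ℂ)}
    (hf : f ∈ blockFunctions n) : f ∈ φ.range := by
  obtain ⟨ψ, hψ, -⟩ := exists_central_functions (n := n)
  have hclosed : IsClosed (φ.range : Set C(stdSimplex ℝ (Fin n),
      Matrix (EvenVertex n) (EvenVertex n) ℂ)) := by
    exact (NonUnitalStarAlgHom.isometry φ
      (representation_injective hφ)).isClosedEmbedding.isClosed_range
  let entry (i j : EvenVertex n) : C(stdSimplex ℝ (Fin n), ℂ) :=
    ⟨fun t => f t i j, (continuous_apply_apply (ρ := fun _ _ => ℂ) i j).comp f.continuous⟩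
  have hsum : f = ∑ i, ∑ j, singleFun i j (entry i j) := by
    ext1 t
    simp only [ContinuousMap.sum_apply]
    exact Matrix.matrix_eq_sum_single (f t)
  rw [hsum]
  refine sum_mem fun i _ => sum_mem fun j _ => ?_
  set L := (Finset.univ.filter fun k => i.1 k ≠ j.1 k).toList with hL
  let m : C(stdSimplex ℝ (Fin n), ℂ) :=
    ⟨fun t => (L.map fun k => (√(t k) : ℂ)).prod, by
      refine continuous_list_prod L fun k _ => Complex.continuous_ofReal.comp
        (Real.continuous_sqrt.comp ((continuous_apply k).comp continuous_subtype_val))⟩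
  have hm : ∀ g, singleFun i j (g * m) ∈ φ.range := by
    intro g
    refine ⟨ψ g * pathProd vertexProj i.1 L, ?_⟩
    change φ (ψ g * pathProd vertexProj i.1 L) = _
    rw [map_mul, representation_pathProd hφ]
    ext1 t
    change φ (ψ g) t * pathProd vertexFun i.1 L t = Matrix.single i j (g t * m t)
    rw [representation_central hφ hψ, pathProd_vertexFun, foldl_flip_filter_ne, vertexVec_even,
      vertexVec_even, ← Algebra.smul_def, smul_smul]
    ext a b
    simp [m, vecMulVec_apply, Matrix.single_apply, Pi.single_apply]
    grind
  have hmem : entry i j ∈ (Ideal.span {m}).closure := by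
    -- A closed ideal consists of all functions that vanish at its common zeros.
    rw [← ContinuousMap.idealOfSet_ofIdeal_eq_closure]
    intro t ht
    rw [Set.mem_compl_iff, ContinuousMap.notMem_setOfIdeal] at ht
    have h0 : m t = 0 := ht (Ideal.subset_span rfl)
    obtain ⟨k, hk, h0⟩ := List.mem_map.1 (List.prod_eq_zero_iff.1 h0)
    have hk0 : t k = 0 := by
      rwa [Complex.ofReal_eq_zero, Real.sqrt_eq_zero ((stdSimplex_coe_mem t).1 k)] at h0
    refine hf t i j fun hr => ?_
    rw [hL, Finset.mem_toList, Finset.mem_filter] at hk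
    exact hk.2 (reachable_coord_eq hk0 hr)
  have hsub : singleFun i j '' (Ideal.span {m} : Set C(stdSimplex ℝ (Fin n), ℂ)) ⊆
      (φ.range : Set C(stdSimplex ℝ (Fin n), Matrix (EvenVertex n) (EvenVertex n) ℂ)) := by
    rintro _ ⟨g, hg, rfl⟩
    obtain ⟨g', rfl⟩ := Ideal.mem_span_singleton'.1 hg
    exact hm g'
  exact closure_minimal hsub hclosed
    (image_closure_subset_closure_image (continuous_singleFun i j) ⟨_, hmem, rfl⟩)

/-- The algebra `C*(Q_n)` is the algebra of block diagonal functions on the simplex. -/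
theorem nonempty_starAlgEquiv_blockFunctions (n : ℕ) :
    Nonempty ((graph n).CStar ≃⋆ₐ[ℂ] blockFunctions n) := by
  obtain ⟨φ, hφ⟩ := exists_representation (n := n)
  refine ⟨StarAlgEquiv.ofBijective
    (φ.codRestrict (blockFunctions n) (representation_mem_blockFunctions hφ)) ⟨?_, ?_⟩⟩
  · exact fun a b hab => representation_injective hφ (congrArg Subtype.val hab)
  · rintro ⟨f, hf⟩
    obtain ⟨a, ha⟩ := mem_range_representation hφ hf
    exact ⟨a, Subtype.ext ha⟩

theorem card_evenVertex {n : ℕ} (hn : 1 ≤ n) : Fintype.card (EvenVertex n) = 2 ^ (n - 1) := by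
  let k : Fin n := ⟨0, hn⟩
  have he : Fintype.card (EvenVertex n) =
      Fintype.card {x : HypercubeVertex n // ¬ Even (weight x)} :=
    Fintype.card_congr
      { toFun := fun x => ⟨flip x.1 k, by rw [even_weight_flip]; simpa using x.2⟩
        invFun := fun x => ⟨flip x.1 k, (even_weight_flip _ _).2 x.2⟩
        left_inv := fun x => by simp
        right_inv := fun x => by simp }
  have h : Fintype.card {x : HypercubeVertex n // ¬ Even (weight x)} =
      Fintype.card (HypercubeVertex n) - Fintype.card (EvenVertex n) :=
    Fintype.card_subtype_compl _
  have h' : Fintype.card (EvenVertex n) ≤ Fintype.card (HypercubeVertex n) :=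
    Fintype.card_subtype_le _
  have hc : Fintype.card (HypercubeVertex n) = 2 * 2 ^ (n - 1) := by
    rw [← pow_succ', Nat.sub_add_cancel hn]
    simp
  omega

end Hypercube

/-! ### The square and the algebra of two projections -/

theorem UniversalCStar.starAlgHom_ext {X : Type*} {R : Set (StarPoly X)} {B : Type*}
    [CStarAlgebra B] {φ ψ : UniversalCStar R →⋆ₐ[ℂ] B} (h : ∀ x, φ (proj x) = ψ (proj x)) :
    φ = ψ := by
  exact StarAlgHom.ext fun a => mem_of_proj_mem (S := StarAlgHom.equalizer φ ψ)
    (isClosed_eq φ.continuous_of_cstarAlgebra ψ.continuous_of_cstarAlgebra) h a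

namespace Hypercube

/-- The even vertices `00` and `11` of the square. -/
def squareEven : Fin 2 ≃ EvenVertex 2 where
  toFun i := ⟨fun _ => i == 1, by revert i; decide⟩
  invFun x := if x.1 0 then 1 else 0
  left_inv := by decide
  right_inv := by decide

/-- The odd vertices `10` and `01` of the square. -/
def squareOdd : Fin 2 ≃ OddVertex 2 where
  toFun i := ⟨fun k => k == i, by revert i; decide⟩
  invFun x := if x.1 0 then 0 else 1
  left_inv := by decide
  right_inv := by decide

theorem squareEven_injective_digit {i j : Fin 2} (k : Fin 2)
    (h : (squareEven i).1 k = (squareEven j).1 k) : i = j := by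
  revert i j k
  decide

theorem graph_two_adj (u : EvenVertex 2) (v : OddVertex 2) : (graph 2).Adj u v := by
  rw [adj_iff]
  revert u v
  decide

theorem sum_proj_inl {n : ℕ} :
    ∑ u, UniversalCStar.proj (R := (graph n).relations) (Sum.inl u) = 1 := by
  simpa [vertexProj_even] using (isCubeFamily_vertexProj (n := n)).sum_even

theorem sum_proj_inr {n : ℕ} :
    ∑ v, UniversalCStar.proj (R := (graph n).relations) (Sum.inr v) = 1 := by
  simpa [vertexProj_odd] using (isCubeFamily_vertexProj (n := n)).sum_odd

/-- The square is a complete bipartite graph with two vertices in each class, so its C*-algebra is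
generated by one projection of each class and their complements, without any further relation. -/
theorem nonempty_starAlgEquiv_square :
    Nonempty (TwoProjectionsCStar ≃⋆ₐ[ℂ] (graph 2).CStar) := by
  let q : Fin 2 → (graph 2).CStar := ![UniversalCStar.proj (Sum.inl (squareEven 0)),
    UniversalCStar.proj (Sum.inr (squareOdd 0))]
  obtain ⟨φ, hφ, -⟩ := UniversalCStar.existsUnique_lift (R := (∅ : Set (StarPoly (Fin 2)))) q
    (by rw [Fin.forall_fin_two]; exact ⟨UniversalCStar.isStarProjection_proj _,
      UniversalCStar.isStarProjection_proj _⟩) (by simp)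
  let p : Fin 2 → TwoProjectionsCStar := UniversalCStar.proj
  have hp : ∀ i, IsStarProjection (p i) := UniversalCStar.isStarProjection_proj
  let r : EvenVertex 2 ⊕ OddVertex 2 → TwoProjectionsCStar :=
    Sum.elim (fun u => ![p 0, 1 - p 0] (squareEven.symm u))
      fun v => ![p 1, 1 - p 1] (squareOdd.symm v)
  obtain ⟨ψ, hψ, -⟩ := UniversalCStar.existsUnique_lift (R := (graph 2).relations) r
    (by
      have : ∀ i j, IsStarProjection (![p i, 1 - p i] j) := fun i =>
        Fin.forall_fin_two.2 ⟨hp i, (hp i).one_sub⟩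
      rintro (u | v)
      · exact this 0 _
      · exact this 1 _) (by
      rintro s ((rfl | rfl) | ⟨u, v, huv, rfl⟩)
      · simp [r, ← squareEven.sum_comp]
      · simp [r, ← squareOdd.sum_comp]
      · exact absurd (graph_two_adj u v) huv)
  have h1 : ψ.comp φ = StarAlgHom.id ℂ _ := UniversalCStar.starAlgHom_ext <| by
    rw [Fin.forall_fin_two]
    constructor <;> simp [hφ, q, hψ, r, p]
  have heven : UniversalCStar.proj (R := (graph 2).relations) (Sum.inl (squareEven 1)) =
      1 - UniversalCStar.proj (Sum.inl (squareEven 0)) := by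
    rw [eq_sub_iff_add_eq', ← sum_proj_inl (n := 2), ← squareEven.sum_comp, Fin.sum_univ_two]
  have hodd : UniversalCStar.proj (R := (graph 2).relations) (Sum.inr (squareOdd 1)) =
      1 - UniversalCStar.proj (Sum.inr (squareOdd 0)) := by
    rw [eq_sub_iff_add_eq', ← sum_proj_inr (n := 2), ← squareOdd.sum_comp, Fin.sum_univ_two]
  have h2 : φ.comp ψ = StarAlgHom.id ℂ _ := UniversalCStar.starAlgHom_ext <| by
    rintro (u | v)
    · obtain ⟨i, rfl⟩ := squareEven.surjective u
      revert i
      rw [Fin.forall_fin_two]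
      constructor <;> simp [hφ, q, hψ, r, p, heven]
    · obtain ⟨i, rfl⟩ := squareOdd.surjective v
      revert i
      rw [Fin.forall_fin_two]
      constructor <;> simp [hφ, q, hψ, r, p, hodd]
  exact ⟨StarAlgEquiv.ofBijective φ ⟨Function.LeftInverse.injective (DFunLike.congr_fun h1),
    Function.RightInverse.surjective (DFunLike.congr_fun h2)⟩⟩

/-- If no direction is removed, then the square is connected. -/
theorem reachable_square {t : Fin 2 → ℝ} (ht : ∀ k, t k ≠ 0) (i j : EvenVertex 2) :
    (graphAt t).toSimpleGraph.Reachable (Sum.inl i) (Sum.inl j) := by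
  have h : ∀ u, (graphAt t).toSimpleGraph.Adj (Sum.inl u) (Sum.inr (squareOdd 0)) := fun u =>
    ⟨by simp, .inl ⟨u, _, rfl, rfl, graph_two_adj _ _, fun k _ => ht k⟩⟩
  exact (h i).reachable.trans (h j).symm.reachable

/-- Restating functions on the one-dimensional simplex as functions on the unit interval. -/
noncomputable def squareFunctions :
    C(stdSimplex ℝ (Fin 2), Matrix (EvenVertex 2) (EvenVertex 2) ℂ) →⋆ₐ[ℂ]
      C(unitInterval, Matrix (Fin 2) (Fin 2) ℂ) where
  toFun f := ⟨fun s => (f (stdSimplexHomeomorphUnitInterval.symm s)).submatrix squareEven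
    squareEven, (f.continuous.comp (Homeomorph.continuous _)).matrix_submatrix _ _⟩
  map_one' := by
    ext1 s
    exact submatrix_one_equiv squareEven
  map_mul' f g := by
    ext1 s
    exact submatrix_mul _ _ _ _ _ squareEven.bijective
  map_zero' := rfl
  map_add' f g := rfl
  commutes' c := by
    ext1 s
    change (algebraMap ℂ (Matrix (EvenVertex 2) (EvenVertex 2) ℂ) c).submatrix _ _ =
      algebraMap ℂ (Matrix (Fin 2) (Fin 2) ℂ) c
    rw [algebraMap_eq_diagonal, algebraMap_eq_diagonal]
    exact submatrix_diagonal_equiv _ _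
  map_star' f := rfl

theorem squareFunctions_apply
    (f : C(stdSimplex ℝ (Fin 2), Matrix (EvenVertex 2) (EvenVertex 2) ℂ)) (s : unitInterval)
    (i j : Fin 2) : squareFunctions f s i j =
      f (stdSimplexHomeomorphUnitInterval.symm s) (squareEven i) (squareEven j) := rfl

theorem squareFunctions_bijective : Function.Bijective squareFunctions := by
  constructor
  · intro f g h
    ext t i j
    have := congrArg (fun f => f (stdSimplexHomeomorphUnitInterval t) (squareEven.symm i)
      (squareEven.symm j)) h
    simpa [squareFunctions_apply] using this
  · intro g
    refine ⟨⟨fun t => (g (stdSimplexHomeomorphUnitInterval t)).submatrix squareEven.symm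
      squareEven.symm, (g.continuous.comp (Homeomorph.continuous _)).matrix_submatrix _ _⟩, ?_⟩
    ext s i j
    simp [squareFunctions_apply]

theorem squareFunctions_mem_iff
    {f : C(stdSimplex ℝ (Fin 2), Matrix (EvenVertex 2) (EvenVertex 2) ℂ)} :
    squareFunctions f ∈ pedersenAlgebra ↔ f ∈ blockFunctions 2 := by
  constructor
  · rintro ⟨h0, h1⟩ t i j hij
    have hne : squareEven.symm i ≠ squareEven.symm j := by
      intro h
      rw [squareEven.symm.injective h] at hij
      exact hij (SimpleGraph.Reachable.refl _)
    have hval : f t i j = squareFunctions f (stdSimplexHomeomorphUnitInterval t)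
        (squareEven.symm i) (squareEven.symm j) := by simp [squareFunctions_apply]
    rw [hval]
    have ht : t 0 = 0 ∨ t 1 = 0 := by
      by_contra! ht
      exact hij (reachable_square (Fin.forall_fin_two.2 ht) i j)
    have hsum : t 0 + t 1 = 1 := (Fin.sum_univ_two t).symm.trans (stdSimplex_coe_mem t).2
    rcases ht with ht | ht
    · have : stdSimplexHomeomorphUnitInterval t = 1 := Subtype.ext (by
        change t 1 = 1
        linarith)
      rw [this]
      exact h1 hne
    · have : stdSimplexHomeomorphUnitInterval t = 0 := Subtype.ext ht
      rw [this]
      exact h0 hne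
  · intro hf
    constructor
    · intro i j hij
      rw [squareFunctions_apply]
      exact hf _ _ _ fun h => hij (squareEven_injective_digit 1 (reachable_coord_eq rfl h))
    · intro i j hij
      rw [squareFunctions_apply]
      exact hf _ _ _ fun h => hij (squareEven_injective_digit 0
        (reachable_coord_eq (sub_self (1 : ℝ)) h))

/-- In dimension two, the block diagonal condition is void in the interior of the interval and
forces diagonal matrices at its endpoints. -/
theorem nonempty_starAlgEquiv_pedersen : Nonempty (blockFunctions 2 ≃⋆ₐ[ℂ] pedersenAlgebra) := by
  refine ⟨StarAlgEquiv.ofBijective ((squareFunctions.comp (blockFunctions 2).subtype).codRestrict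
    pedersenAlgebra fun f => squareFunctions_mem_iff.2 f.2) ⟨fun f g h => ?_, ?_⟩⟩
  · exact Subtype.ext (squareFunctions_bijective.1 (congrArg Subtype.val h))
  · rintro ⟨g, hg⟩
    obtain ⟨f, rfl⟩ := squareFunctions_bijective.2 g
    exact ⟨⟨f, squareFunctions_mem_iff.1 hg⟩, rfl⟩

end Hypercube

theorem mainTheorem3 :
    (∀ n : ℕ, 1 ≤ n →
      Fintype.card (Hypercube.EvenVertex n) = 2 ^ (n - 1) ∧
      Nonempty ((Hypercube.graph n).CStar ≃⋆ₐ[ℂ] Hypercube.blockFunctions n)) ∧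
    Nonempty (TwoProjectionsCStar ≃⋆ₐ[ℂ] (Hypercube.graph 2).CStar) ∧
    Nonempty (TwoProjectionsCStar ≃⋆ₐ[ℂ] pedersenAlgebra) := by
  obtain ⟨e₁⟩ := Hypercube.nonempty_starAlgEquiv_square
  obtain ⟨e₂⟩ := Hypercube.nonempty_starAlgEquiv_blockFunctions 2
  obtain ⟨e₃⟩ := Hypercube.nonempty_starAlgEquiv_pedersen
  exact ⟨fun n hn => ⟨Hypercube.card_evenVertex hn,
    Hypercube.nonempty_starAlgEquiv_blockFunctions n⟩, ⟨e₁⟩, ⟨(e₁.trans e₂).trans e₃⟩⟩
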